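/- Let $a>0$ and $t>0$ be real, and let $\mu,\nu\in\mathbb C$ satisfy $$\operatorname{Re}\nu>-1,\qquad \operatorname{Re}(\mu+\nu)>-1,\qquad \operatorname{Re}(2\mu+\nu)>-\tfrac32,\qquad \mu\notin\{-1,-2,-3,\dots\}.$$ (If $-1<\operatorname{Re}\nu\le-\tfrac12$, the last two conditions follow from $\operatorname{Re}(\mu+\nu)>-1$.) Then the integral below converges (at infinity as an improper integral $\lim_{R\to\infty}\int_0^R$, possibly only conditionally), and $$(at)^{\mu+\nu}\,{}_0F_3(\mu+1,\nu+1,\mu+\nu+1;-a^2t^2)\,K_\mu(t)=\Gamma(\mu+1)\Gamma(\nu+1)\Gamma(\mu+\nu+1)\int_0^\infty\frac{y}{1+y^2}\,J_\nu(ty)\,J_\mu\!\Big(\frac{4a}{1+y^2}\Big)I_\nu\!\Big(\frac{4ay}{1+y^2}\Big)\,dy .$$ Here $J_\nu,I_\nu$ are the Bessel and modified Bessel functions of the first kind, $K_\mu$ is the modified Bessel function of the second kind, and ${}_0F_3(b_1,b_2,b_3;z)=\sum_{n\ge0}\frac{z^n}{(b_1)_n(b_2)_n(b_3)_n\,n!}$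 with $(b)_n=b(b+1)\cdots(b+n-1)$. -/

import Mathlib

open MeasureTheory Filter Topology

/-- The Bessel function of the first kind `J_ν(z)` of complex order `ν` (principal branch of
`(z/2)^ν`). The reciprocal Gamma function is entire and vanishes at the nonpositive integers, in
agreement with the convention `Complex.Gamma (-n) = 0` and `0⁻¹ = 0`. -/
noncomputable def besselJ (ν z : ℂ) : ℂ :=
  (z / 2) ^ ν * ∑' k : ℕ, (-1) ^ k * (z / 2) ^ (2 * k) /
    ((k.factorial : ℂ) * Complex.Gamma (ν + k + 1))

/-- The modified Bessel function of the first kind `I_ν(z)` of complex order `ν`. -/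
noncomputable def besselI (ν z : ℂ) : ℂ :=
  (z / 2) ^ ν * ∑' k : ℕ, (z / 2) ^ (2 * k) /
    ((k.factorial : ℂ) * Complex.Gamma (ν + k + 1))

/-- The modified Bessel function of the second kind (Macdonald function) `K_μ(x)` of complex
order `μ` at a positive real argument `x`: `K_μ(x) = ∫_0^∞ exp(-x cosh u) cosh(μ u) du`, an
absolutely convergent integral for every `μ`. -/
noncomputable def besselK (μ : ℂ) (x : ℝ) : ℂ :=
  ∫ u in Set.Ioi (0 : ℝ), (Real.exp (-x * Real.cosh u) : ℂ) * Complex.cosh (μ * u)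

/-- The generalized hypergeometric function
`₀F₃(b₁, b₂, b₃; z) = ∑ₙ zⁿ / ((b₁)ₙ (b₂)ₙ (b₃)ₙ n!)`, with `(b)ₙ` the rising factorial, for
parameters that are not nonpositive integers. -/
noncomputable def hypergeometric0F3 (b₁ b₂ b₃ z : ℂ) : ℂ :=
  ∑' n : ℕ, z ^ n / ((ascPochhammer ℂ n).eval b₁ * (ascPochhammer ℂ n).eval b₂ *
    (ascPochhammer ℂ n).eval b₃ * (n.factorial : ℂ))

/-- `HasImproperIntegral f L`: the integral `∫_0^∞ f(y) dy` converges to `L`, in the sense that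
`f` is integrable over `(0, R]` for every `R > 0` and `∫_0^R f(y) dy → L` as `R → ∞`. -/
def HasImproperIntegral (f : ℝ → ℂ) (L : ℂ) : Prop :=
  (∀ R : ℝ, 0 < R → IntervalIntegrable f volume 0 R) ∧
    Tendsto (fun R : ℝ => ∫ y in (0 : ℝ)..R, f y) atTop (𝓝 L)

/-! Put `Y = 1 + y²`, `c = t/2`, and let `B_ν` denote `besselEntire ν`. Once the powers are
extracted from the three Bessel functions, the integrand is a constant times `y^(2ν+1) Y^(-(μ+ν+1))
B_ν(-(cy)²)` times the product of a `J_μ`-series and an `I_ν`-series in `(2a)²`. Since `y² = Y - 1`,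
the coefficient of `(2a)^(2n)` in that product is `Y^(-2n)` times a polynomial in `Y`, whose
coefficients come from a Vandermonde convolution of reciprocal Gammas
(`sum_antidiagonal_sub_one_pow`).

Powers of `Y` only shift `s` in the Basset integral `∫ y^(2ν+1) Y^(-(s+1)) B_ν(-(cy)²) dy = c^(s-ν)
K_{s-ν}(2c) / Γ(s+1)` (`hasImproperIntegral_bassetKernel`). The term of index `n` thus integrates to
a finite combination of `K_{μ+n+m}(t)`, `0 ≤ m ≤ n`, with `s = μ + ν + n + m`. The Pochhammer
factors cancel against `Γ(s+1)`, and the remaining binomial sum collapses to a multiple of `K_μ(t)`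
(`besselKSum_eq`). Hence `K_μ(t)` factors out of every term, and what is left is the `₀F₃` series.

For convergence, an energy estimate gives `B_ν(-(cy)²) = O(y^(-Re ν - 1/2))`. Only the term `n = 0`
may converge conditionally, and it is handled by one integration by parts. Every later term carries
at least one extra factor `Y⁻¹` and is dominated by a summable multiple of one fixed integrable
function. -/

/-! ### The regularised `₀F₁`: convergence, derivative, recurrence -/

/-- The entire function `∑ wᵏ / (k! Γ(ν + k + 1))`, the regularised `₀F₁(; ν + 1; w)`. -/
noncomputable def besselEntire (ν w : ℂ) : ℂ :=
  ∑' k : ℕ, w ^ k / ((k.factorial : ℂ) * Complex.Gamma (ν + k + 1))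

theorem inv_Gamma_add_one (s : ℂ) :
    (Complex.Gamma s)⁻¹ = s * (Complex.Gamma (s + 1))⁻¹ :=
  Complex.one_div_Gamma_eq_self_mul_one_div_Gamma_add_one s

theorem exists_bound_inv_Gamma (ν : ℂ) :
    ∃ C : ℝ, 0 ≤ C ∧ ∀ k : ℕ, ‖(Complex.Gamma (ν + k + 1))⁻¹‖ ≤ C := by
  -- From index `N` on, `‖ν + k + 1‖ ≥ 1`, so the functional equation makes the norms nonincreasing;
  -- the finitely many earlier ones are summed.
  obtain ⟨N, hN⟩ := exists_nat_ge (‖ν‖ + 1)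
  have key : ∀ k : ℕ, ‖(Complex.Gamma (ν + (N + k : ℕ) + 1))⁻¹‖ ≤
      ‖(Complex.Gamma (ν + N + 1))⁻¹‖ := by
    intro k
    induction k with
    | zero => simp
    | succ k ih =>
      refine le_trans ?_ ih
      rw [inv_Gamma_add_one (ν + (N + k : ℕ) + 1), norm_mul]
      have h1 : (1 : ℝ) ≤ ‖ν + (N + k : ℕ) + 1‖ := by
        have := norm_sub_norm_le ((N + k + 1 : ℕ) : ℂ) (-ν)
        rw [Complex.norm_natCast, norm_neg] at this
        have e : ((N + k + 1 : ℕ) : ℂ) - -ν = ν + (N + k : ℕ) + 1 := by push_cast; ring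
        rw [e] at this
        push_cast at this
        have : (0 : ℝ) ≤ k := by positivity
        push_cast
        push_cast at *
        linarith
      have e2 : ν + ((N + (k + 1) : ℕ) : ℂ) + 1 = ν + (N + k : ℕ) + 1 + 1 := by push_cast; ring
      rw [e2]
      exact le_mul_of_one_le_left (norm_nonneg _) h1
  refine ⟨∑ k ∈ Finset.range (N + 1), ‖(Complex.Gamma (ν + k + 1))⁻¹‖,
    Finset.sum_nonneg fun _ _ => norm_nonneg _, fun k => ?_⟩
  rcases le_or_gt k N with h | h
  · exact Finset.single_le_sum (f := fun k : ℕ => ‖(Complex.Gamma (ν + k + 1))⁻¹‖)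
      (fun _ _ => norm_nonneg _) (Finset.mem_range.2 (Nat.lt_succ_of_le h))
  · obtain ⟨m, rfl⟩ := Nat.exists_eq_add_of_le h.le
    refine (key m).trans ?_
    exact Finset.single_le_sum (f := fun k : ℕ => ‖(Complex.Gamma (ν + k + 1))⁻¹‖)
      (fun _ _ => norm_nonneg _) (Finset.mem_range.2 (Nat.lt_succ_self N))

theorem summable_norm_besselEntire (ν w : ℂ) :
    Summable fun k : ℕ => ‖w ^ k / ((k.factorial : ℂ) * Complex.Gamma (ν + k + 1))‖ := by
  obtain ⟨C, hC, h⟩ := exists_bound_inv_Gamma ν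
  refine Summable.of_nonneg_of_le (fun _ => norm_nonneg _) (fun k => ?_)
    ((Real.summable_pow_div_factorial ‖w‖).mul_right C)
  rw [div_mul_eq_div_div, div_eq_mul_inv _ (Complex.Gamma _), norm_mul, norm_div, norm_pow,
    Complex.norm_natCast]
  exact mul_le_mul_of_nonneg_left (h k) (by positivity)

theorem summable_besselEntire (ν w : ℂ) :
    Summable fun k : ℕ => w ^ k / ((k.factorial : ℂ) * Complex.Gamma (ν + k + 1)) :=
  (summable_norm_besselEntire ν w).of_norm

theorem besselEntire_deriv_term (ν w : ℂ) (k : ℕ) :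
    ((k + 1 : ℕ) : ℂ) * w ^ k / (((k + 1).factorial : ℂ) * Complex.Gamma (ν + (k + 1 : ℕ) + 1)) =
      w ^ k / ((k.factorial : ℂ) * Complex.Gamma (ν + 1 + k + 1)) := by
  have e : ν + ((k + 1 : ℕ) : ℂ) + 1 = ν + 1 + k + 1 := by push_cast; ring
  rw [e, Nat.factorial_succ, Nat.cast_mul, mul_assoc]
  exact mul_div_mul_left _ _ (Nat.cast_ne_zero.2 k.succ_ne_zero)

theorem hasDerivAt_besselEntire (ν w : ℂ) :
    HasDerivAt (besselEntire ν) (besselEntire (ν + 1) w) w := by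
  obtain ⟨C, hC, h⟩ := exists_bound_inv_Gamma ν
  set R : ℝ := ‖w‖ + 1 with hR
  have hR0 : 0 < R := by positivity
  have hu : Summable fun k : ℕ => (k : ℝ) * R ^ (k - 1) / k.factorial * C := by
    refine Summable.mul_right C ?_
    rw [← summable_nat_add_iff 1]
    refine (Real.summable_pow_div_factorial R).congr fun k => ?_
    rw [Nat.factorial_succ, Nat.cast_mul, Nat.add_sub_cancel]
    exact (mul_div_mul_left _ _ (Nat.cast_ne_zero.2 k.succ_ne_zero)).symm
  have hd := hasDerivAt_tsum_of_isPreconnected (𝕜 := ℂ) (y₀ := w) (y := w)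
    (g := fun (k : ℕ) (z : ℂ) => z ^ k / ((k.factorial : ℂ) * Complex.Gamma (ν + k + 1)))
    (g' := fun (k : ℕ) (z : ℂ) =>
      (k : ℂ) * z ^ (k - 1) / ((k.factorial : ℂ) * Complex.Gamma (ν + k + 1)))
    hu Metric.isOpen_ball (convex_ball (0 : ℂ) R).isPreconnected
    (fun k y _ => (hasDerivAt_pow k y).div_const _) (fun k y hy => ?_)
    (by simp [hR]) (summable_besselEntire ν w) (by simp [hR])
  · refine hd.congr_deriv ?_
    rw [tsum_eq_zero_add']
    · simp only [Nat.cast_zero, zero_mul, zero_div, zero_add, Nat.add_sub_cancel]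
      exact tsum_congr fun k => besselEntire_deriv_term ν w k
    · refine (summable_besselEntire (ν + 1) w).congr fun k => ?_
      exact (besselEntire_deriv_term ν w k).symm
  · have hy' : ‖y‖ ≤ R := (mem_ball_zero_iff.1 hy).le
    rw [div_mul_eq_div_div, div_eq_mul_inv _ (Complex.Gamma _), norm_mul, norm_div, norm_mul,
      norm_pow, Complex.norm_natCast, Complex.norm_natCast]
    exact mul_le_mul (by gcongr) (h k) (norm_nonneg _) (by positivity)

theorem continuous_besselEntire (ν : ℂ) : Continuous (besselEntire ν) :=
  continuous_iff_continuousAt.2 fun w => (hasDerivAt_besselEntire ν w).continuousAt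

theorem besselEntire_recurrence (ν w : ℂ) :
    besselEntire ν w = (ν + 1) * besselEntire (ν + 1) w + w * besselEntire (ν + 2) w := by
  have h1 : ∀ k : ℕ, w ^ k / ((k.factorial : ℂ) * Complex.Gamma (ν + k + 1)) =
      (ν + 1) * (w ^ k / ((k.factorial : ℂ) * Complex.Gamma (ν + 1 + k + 1))) +
      (k : ℂ) * (w ^ k / ((k.factorial : ℂ) * Complex.Gamma (ν + 1 + k + 1))) := by
    intro k
    have e : ν + 1 + k + 1 = ν + k + 1 + 1 := by ring
    rw [e, div_mul_eq_div_div, div_mul_eq_div_div, div_eq_mul_inv _ (Complex.Gamma _),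
      div_eq_mul_inv _ (Complex.Gamma _), inv_Gamma_add_one (ν + k + 1)]
    ring
  have e2 : ∀ k : ℕ, ((k + 1 : ℕ) : ℂ) *
      (w ^ (k + 1) / (((k + 1).factorial : ℂ) * Complex.Gamma (ν + 1 + (k + 1 : ℕ) + 1))) =
      w * (w ^ k / ((k.factorial : ℂ) * Complex.Gamma (ν + 2 + k + 1))) := by
    intro k
    have := besselEntire_deriv_term (ν + 1) w k
    rw [show ν + 2 + (k : ℂ) + 1 = ν + 1 + 1 + k + 1 by ring, ← this]
    ring
  set g : ℕ → ℂ := fun k =>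
    (k : ℂ) * (w ^ k / ((k.factorial : ℂ) * Complex.Gamma (ν + 1 + k + 1))) with hg
  have hs : Summable fun k : ℕ => g (k + 1) :=
    ((summable_besselEntire (ν + 2) w).mul_left w).congr fun k => (e2 k).symm
  have hg1 : ∑' k, g k = w * besselEntire (ν + 2) w := by
    rw [tsum_eq_zero_add' hs, besselEntire, ← tsum_mul_left]
    simp only [hg, Nat.cast_zero, zero_mul, zero_add]
    exact tsum_congr e2
  have hg2 : Summable g := (summable_nat_add_iff 1).1 hs
  calc besselEntire ν w = ∑' k : ℕ, ((ν + 1) *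
        (w ^ k / ((k.factorial : ℂ) * Complex.Gamma (ν + 1 + k + 1))) + g k) := tsum_congr h1
    _ = _ := by
      rw [((summable_besselEntire (ν + 1) w).mul_left _).tsum_add hg2, tsum_mul_left, hg1]
      rfl

/-! ### Decay of `B_ν(-(cy)²)` at infinity -/

theorem hasDerivAt_ofReal_cpow {x : ℝ} (hx : 0 < x) (r : ℂ) :
    HasDerivAt (fun y : ℝ => (y : ℂ) ^ r) (r * (x : ℂ) ^ (r - 1)) x := by
  have := (((hasDerivAt_id (x : ℂ)).cpow_const (c := r)
    (Complex.ofReal_mem_slitPlane.2 hx)).comp_ofReal)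
  simpa using this

theorem hasDerivAt_besselEntire_neg_sq (ν : ℂ) (c x : ℝ) :
    HasDerivAt (fun y : ℝ => besselEntire ν (-((c * y : ℝ) : ℂ) ^ 2))
      (-(2 * c ^ 2 * x) * besselEntire (ν + 1) (-((c * x : ℝ) : ℂ) ^ 2)) x := by
  have h1 : HasDerivAt (fun y : ℝ => -((c * y : ℝ) : ℂ) ^ 2) (-(2 * c ^ 2 * x : ℂ)) x := by
    have : HasDerivAt (fun y : ℂ => -((c : ℂ) * y) ^ 2) (-(2 * c ^ 2 * x : ℂ)) (x : ℂ) := by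
      refine ((((hasDerivAt_id (x : ℂ)).const_mul (c : ℂ)).pow 2).neg).congr_deriv ?_
      simp; ring
    simpa using this.comp_ofReal
  refine ((hasDerivAt_besselEntire ν _).comp x h1).congr_deriv ?_
  ring

theorem continuous_besselEntire_neg_sq (ν : ℂ) (c : ℝ) :
    Continuous fun y : ℝ => besselEntire ν (-((c * y : ℝ) : ℂ) ^ 2) :=
  (continuous_besselEntire ν).comp (by fun_prop)

/-- The system is `a'' + (1 - c/x²) a = 0`. The energy `‖a‖² + ‖w‖²` changes at a rate at most
`‖c‖/x²` times itself, because the oscillator part cancels. The weight `exp(‖c‖/x)` has logarithmic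
derivative `-‖c‖/x²`, which makes the product nonincreasing. -/
theorem energy_bound {a w : ℝ → ℂ} {c : ℂ}
    (ha : ∀ x : ℝ, 0 < x → HasDerivAt a (-w x) x)
    (hw : ∀ x : ℝ, 0 < x → HasDerivAt w ((1 - c / (x : ℂ) ^ 2) * a x) x) :
    ∃ C : ℝ, ∀ x : ℝ, 1 ≤ x → ‖a x‖ ≤ C := by
  set E : ℝ → ℝ := fun x => (‖a x‖ ^ 2 + ‖w x‖ ^ 2) * Real.exp (‖c‖ / x) with hE
  have hd : ∀ x : ℝ, 0 < x → HasDerivAt E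
      ((2 * inner ℝ (a x) (-w x) + 2 * inner ℝ (w x) ((1 - c / (x : ℂ) ^ 2) * a x)) *
        Real.exp (‖c‖ / x) +
        (‖a x‖ ^ 2 + ‖w x‖ ^ 2) * (Real.exp (‖c‖ / x) * (‖c‖ * (-(x ^ 2)⁻¹)))) x := by
    intro x hx
    refine ((ha x hx).norm_sq.add (hw x hx).norm_sq).mul ?_
    have := (((hasDerivAt_inv hx.ne').const_mul ‖c‖)).exp
    simpa [div_eq_mul_inv] using this
  have hle : ∀ x : ℝ, 0 < x →
      (2 * inner ℝ (a x) (-w x) + 2 * inner ℝ (w x) ((1 - c / (x : ℂ) ^ 2) * a x)) *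
        Real.exp (‖c‖ / x) +
        (‖a x‖ ^ 2 + ‖w x‖ ^ 2) * (Real.exp (‖c‖ / x) * (‖c‖ * (-(x ^ 2)⁻¹))) ≤ 0 := by
    intro x hx
    have h1 : 2 * inner ℝ (a x) (-w x) + 2 * inner ℝ (w x) ((1 - c / (x : ℂ) ^ 2) * a x) =
        2 * inner ℝ (w x) (-(c / (x : ℂ) ^ 2 * a x)) := by
      have : (1 - c / (x : ℂ) ^ 2) * a x = a x + -(c / (x : ℂ) ^ 2 * a x) := by ring
      rw [this, inner_add_right, inner_neg_right, real_inner_comm]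
      ring
    have h2 : inner ℝ (w x) (-(c / (x : ℂ) ^ 2 * a x)) ≤ ‖w x‖ * (‖c‖ * (x ^ 2)⁻¹ * ‖a x‖) := by
      refine (real_inner_le_norm _ _).trans (le_of_eq ?_)
      rw [norm_neg, norm_mul, norm_div, norm_pow, Complex.norm_real, Real.norm_eq_abs, sq_abs,
        div_eq_mul_inv]
    have h3 : 2 * (‖w x‖ * (‖c‖ * (x ^ 2)⁻¹ * ‖a x‖)) ≤
        (‖c‖ * (x ^ 2)⁻¹) * (‖a x‖ ^ 2 + ‖w x‖ ^ 2) := by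
      have : 0 ≤ ‖c‖ * (x ^ 2)⁻¹ := by positivity
      nlinarith [mul_nonneg this (sq_nonneg (‖a x‖ - ‖w x‖))]
    rw [h1]
    have h4 : 2 * inner ℝ (w x) (-(c / (x : ℂ) ^ 2 * a x)) -
        (‖c‖ * (x ^ 2)⁻¹) * (‖a x‖ ^ 2 + ‖w x‖ ^ 2) ≤ 0 := by linarith
    have := mul_nonpos_of_nonpos_of_nonneg h4 (Real.exp_pos (‖c‖ / x)).le
    linarith
  have hanti : AntitoneOn E (Set.Ici 1) := by
    refine antitoneOn_of_deriv_nonpos (convex_Ici 1) (fun x hx => ?_) (fun x hx => ?_)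
      (fun x hx => ?_)
    · exact (hd x (zero_lt_one.trans_le hx)).continuousAt.continuousWithinAt
    · rw [interior_Ici] at hx
      exact (hd x (zero_lt_one.trans hx)).differentiableAt.differentiableWithinAt
    · rw [interior_Ici] at hx
      rw [(hd x (zero_lt_one.trans hx)).deriv]
      exact hle x (zero_lt_one.trans hx)
  refine ⟨Real.sqrt (E 1), fun x hx => Real.le_sqrt_of_sq_le ?_⟩
  refine le_trans ?_ (hanti (Set.self_mem_Ici) hx hx)
  have : 1 ≤ Real.exp (‖c‖ / x) := Real.one_le_exp (by positivity)
  nlinarith [sq_nonneg ‖a x‖, sq_nonneg ‖w x‖]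

/-- Up to a constant, `x^(ν+1/2) B_ν(-(x/2)²)` is `√x J_ν(x)`, the Liouville normal form of Bessel's
equation, to which `energy_bound` applies with `c = κ² - κ = ν² - 1/4`. -/
theorem exists_bound_besselEntire_of_one_le (ν : ℂ) :
    ∃ C : ℝ, ∀ x : ℝ, 1 ≤ x →
      ‖besselEntire ν (-((1 / 2 * x : ℝ) : ℂ) ^ 2)‖ ≤ C * x ^ (-(ν.re + 1 / 2)) := by
  set κ : ℂ := ν + 1 / 2 with hκ
  set P : ℂ → ℝ → ℂ := fun ν y => besselEntire ν (-((1 / 2 * y : ℝ) : ℂ) ^ 2) with hP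
  have dP : ∀ (ν : ℂ) (x : ℝ), HasDerivAt (P ν) (-(x / 2) * P (ν + 1) x) x := by
    intro ν x
    refine (hasDerivAt_besselEntire_neg_sq ν (1 / 2) x).congr_deriv ?_
    simp only [hP]; push_cast; ring
  have hrec : ∀ x : ℝ, P ν x = (ν + 1) * P (ν + 1) x - (x : ℂ) ^ 2 / 4 * P (ν + 2) x := by
    intro x
    simp only [hP]
    rw [besselEntire_recurrence ν]
    push_cast; ring
  have d1 : ∀ x : ℝ, 0 < x → HasDerivAt (fun x : ℝ => (x : ℂ) ^ κ * P ν x)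
      (-((x : ℂ) ^ (κ + 1) / 2 * P (ν + 1) x - κ * (x : ℂ) ^ (κ - 1) * P ν x)) x := by
    intro x hx
    refine ((hasDerivAt_ofReal_cpow hx κ).mul (dP ν x)).congr_deriv ?_
    have hx' : (x : ℂ) ≠ 0 := Complex.ofReal_ne_zero.2 hx.ne'
    rw [Complex.cpow_add κ 1 hx', Complex.cpow_one]
    ring
  have d2 : ∀ x : ℝ, 0 < x → HasDerivAt
      (fun x : ℝ => (x : ℂ) ^ (κ + 1) / 2 * P (ν + 1) x - κ * (x : ℂ) ^ (κ - 1) * P ν x)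
      ((1 - (κ ^ 2 - κ) / (x : ℂ) ^ 2) * ((x : ℂ) ^ κ * P ν x)) x := by
    intro x hx
    have hx' : (x : ℂ) ≠ 0 := Complex.ofReal_ne_zero.2 hx.ne'
    refine ((((hasDerivAt_ofReal_cpow hx (κ + 1)).div_const 2).mul (dP (ν + 1) x)).sub
      (((hasDerivAt_ofReal_cpow hx (κ - 1)).const_mul κ).mul (dP ν x))).congr_deriv ?_
    have e1 : (x : ℂ) ^ (κ + 1) = (x : ℂ) ^ κ * x := by
      rw [Complex.cpow_add _ _ hx', Complex.cpow_one]
    have e2 : (x : ℂ) ^ (κ - 1) = (x : ℂ) ^ κ / x := by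
      rw [Complex.cpow_sub _ _ hx', Complex.cpow_one]
    have e3 : (x : ℂ) ^ (κ - 1 - 1) = (x : ℂ) ^ κ / x / x := by
      rw [Complex.cpow_sub _ _ hx', Complex.cpow_one, e2]
    rw [e1, e2, e3, add_sub_cancel_right, show ν + 1 + 1 = ν + 2 by ring, hrec x]
    simp only [hκ]
    field_simp
    ring
  obtain ⟨C, hC⟩ := energy_bound d1 d2
  refine ⟨C, fun x hx => ?_⟩
  have hx0 : 0 < x := zero_lt_one.trans_le hx
  have h := hC x hx
  rw [norm_mul, Complex.norm_cpow_eq_rpow_re_of_pos hx0] at h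
  rw [Real.rpow_neg hx0.le, ← div_eq_mul_inv, le_div_iff₀ (Real.rpow_pos_of_pos hx0 _), mul_comm]
  simpa [hκ, hP] using h

theorem one_add_sq_rpow_le {y₀ y : ℝ} (h₀ : 0 < y₀) (h : y₀ ≤ y) (q : ℝ) :
    (1 + y ^ 2) ^ q ≤ (1 + (y₀ ^ 2)⁻¹) ^ |q| * y ^ (2 * q) := by
  have hy : 0 < y := h₀.trans_le h
  have e : 1 + y ^ 2 = (1 + (y ^ 2)⁻¹) * y ^ 2 := by field_simp; ring
  rw [e, Real.mul_rpow (by positivity) (by positivity), ← Real.rpow_natCast y 2,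
    ← Real.rpow_mul hy.le]
  push_cast
  refine mul_le_mul_of_nonneg_right ?_ (by positivity)
  -- The base is at least 1, so passing to `|q|` covers both signs of the exponent.
  calc (1 + (y ^ (2 : ℝ))⁻¹) ^ q ≤ (1 + (y ^ (2 : ℝ))⁻¹) ^ |q| :=
        Real.rpow_le_rpow_of_exponent_le (by simp; positivity) (le_abs_self q)
    _ ≤ _ := by
        refine Real.rpow_le_rpow (by positivity) ?_ (abs_nonneg q)
        rw [Real.rpow_ofNat]
        gcongr

theorem exists_bound_besselEntire (ν : ℂ) {c : ℝ} (hc : 0 < c) :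
    ∃ C : ℝ, 0 ≤ C ∧ ∀ y : ℝ, 0 ≤ y → ‖besselEntire ν (-((c * y : ℝ) : ℂ) ^ 2)‖ ≤
      C * (1 + y ^ 2) ^ (-(ν.re / 2 + 1 / 4)) := by
  set q : ℝ := ν.re / 2 + 1 / 4 with hq
  obtain ⟨C, hC⟩ := exists_bound_besselEntire_of_one_le ν
  have hcont : Continuous fun y : ℝ => besselEntire ν (-((c * y : ℝ) : ℂ) ^ 2) *
      (((1 + y ^ 2) ^ q : ℝ) : ℂ) := by
    refine (continuous_besselEntire_neg_sq ν c).mul (Complex.continuous_ofReal.comp ?_)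
    exact (by fun_prop : Continuous fun y : ℝ => 1 + y ^ 2).rpow_const
      fun y => Or.inl (by positivity)
  -- The estimate at infinity needs `2cy ≥ 1`; below that threshold compactness suffices.
  obtain ⟨D, hD⟩ := (isCompact_Icc (a := (0 : ℝ)) (b := 1 / (2 * c))).exists_bound_of_continuousOn
    hcont.continuousOn
  set D' : ℝ := C * (2 * c) ^ (-(ν.re + 1 / 2)) * (1 + ((1 / (2 * c)) ^ 2)⁻¹) ^ |q| with hD'
  have key : ∀ y : ℝ, 0 ≤ y → ‖besselEntire ν (-((c * y : ℝ) : ℂ) ^ 2)‖ * (1 + y ^ 2) ^ q ≤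
      max D D' := by
    intro y hy
    have hpos : 0 ≤ (1 + y ^ 2) ^ q := by positivity
    rcases le_total y (1 / (2 * c)) with h | h
    · refine le_trans (le_of_eq ?_) ((hD y ⟨hy, h⟩).trans (le_max_left _ _))
      rw [norm_mul, Complex.norm_real, Real.norm_of_nonneg hpos]
    · refine le_trans ?_ (le_max_right _ _)
      have hy0 : 0 < y := lt_of_lt_of_le (by positivity) h
      have h1 : 1 ≤ 2 * c * y := by
        rw [div_le_iff₀ (by positivity)] at h; linarith
      have hb := hC (2 * c * y) h1
      rw [show (1 / 2 * (2 * c * y) : ℝ) = c * y by ring] at hb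
      rw [Real.mul_rpow (by positivity) hy] at hb
      have hm := mul_le_mul hb (one_add_sq_rpow_le (by positivity) h q) hpos
        ((norm_nonneg _).trans hb)
      refine hm.trans (le_of_eq ?_)
      have e : y ^ (-(ν.re + 1 / 2)) * y ^ (2 * q) = 1 := by
        rw [← Real.rpow_add hy0, hq]; ring_nf; simp
      rw [hD']
      linear_combination (C * (2 * c) ^ (-(ν.re + 1 / 2)) *
        (1 + ((1 / (2 * c)) ^ 2)⁻¹) ^ |q|) * e
  refine ⟨max D D', ?_, fun y hy => ?_⟩
  · exact (by positivity : (0:ℝ) ≤ ‖_‖ * (1 + (0:ℝ) ^ 2) ^ q).trans (key 0 le_rfl)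
  · have hpos : 0 < (1 + y ^ 2) ^ q := by positivity
    rw [Real.rpow_neg (by positivity), ← div_eq_mul_inv, le_div_iff₀ hpos]
    exact key y hy

/-! ### The Basset kernel and its absolute integrability -/

theorem integrableOn_rpow_mul_one_add_sq_rpow {p q : ℝ} (hp : -1 < p) (hpq : p - 2 * q < -1) :
    IntegrableOn (fun y : ℝ => y ^ p * (1 + y ^ 2) ^ (-q)) (Set.Ioi 0) := by
  have hc : Continuous fun y : ℝ => (1 + y ^ 2) ^ (-q) :=
    (by fun_prop : Continuous fun y : ℝ => 1 + y ^ 2).rpow_const fun y => Or.inl (by positivity)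
  -- This is a Mellin transform at `p + 1` of a function bounded near 0 and of order `y^(-2q)` at
  -- infinity.
  have := mellin_convergent_of_isBigO_scalar (a := 2 * q) (b := 0) (s := p + 1)
    (f := fun y : ℝ => (1 + y ^ 2) ^ (-q)) (hc.locallyIntegrable.locallyIntegrableOn _) ?_
    (by linarith) ?_ (by linarith)
  · simpa using this
  · refine Asymptotics.IsBigO.of_bound ((1 + ((1:ℝ) ^ 2)⁻¹) ^ |-q|) ?_
    filter_upwards [eventually_ge_atTop 1] with y hy
    have hy0 : 0 < y := zero_lt_one.trans_le hy
    rw [Real.norm_of_nonneg (by positivity), Real.norm_of_nonneg (by positivity)]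
    refine (one_add_sq_rpow_le zero_lt_one hy (-q)).trans (le_of_eq ?_)
    ring_nf
  · simp only [neg_zero, Real.rpow_zero]
    exact (hc.tendsto 0).isBigO_one ℝ |>.mono nhdsWithin_le_nhds

/-- The integrand of the Basset-type integral. -/
noncomputable def bassetKernel (c : ℝ) (ν s : ℂ) (y : ℝ) : ℂ :=
  (y : ℂ) ^ (2 * ν + 1) * ((1 + y ^ 2 : ℝ) : ℂ) ^ (-(s + 1)) *
    besselEntire ν (-((c * y : ℝ) : ℂ) ^ 2)

theorem continuousOn_ofReal_cpow (r : ℂ) :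
    ContinuousOn (fun y : ℝ => (y : ℂ) ^ r) (Set.Ioi 0) := fun _ hy =>
  (hasDerivAt_ofReal_cpow hy r).continuousAt.continuousWithinAt

theorem continuous_one_add_sq_cpow (r : ℂ) :
    Continuous fun y : ℝ => ((1 + y ^ 2 : ℝ) : ℂ) ^ r := by
  refine continuous_iff_continuousAt.2 fun y => ?_
  exact (hasDerivAt_ofReal_cpow (by positivity : 0 < 1 + y ^ 2) r).continuousAt.comp
    (f := fun y : ℝ => 1 + y ^ 2) (by fun_prop)

theorem continuousOn_bassetKernel (c : ℝ) (ν s : ℂ) :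
    ContinuousOn (bassetKernel c ν s) (Set.Ioi 0) :=
  ((continuousOn_ofReal_cpow _).mul (continuous_one_add_sq_cpow _).continuousOn).mul
    (continuous_besselEntire_neg_sq ν c).continuousOn

theorem norm_bassetKernel {c : ℝ} (ν s : ℂ) {y : ℝ} (hy : 0 < y) :
    ‖bassetKernel c ν s y‖ = y ^ (2 * ν.re + 1) * (1 + y ^ 2) ^ (-(s.re + 1)) *
      ‖besselEntire ν (-((c * y : ℝ) : ℂ) ^ 2)‖ := by
  rw [bassetKernel, norm_mul, norm_mul, Complex.norm_cpow_eq_rpow_re_of_pos hy,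
    Complex.norm_cpow_eq_rpow_re_of_pos (by positivity)]
  simp

theorem exists_bound_bassetKernel {c : ℝ} (hc : 0 < c) (ν s : ℂ) :
    ∃ C : ℝ, 0 ≤ C ∧ ∀ y : ℝ, 0 < y → ‖bassetKernel c ν s y‖ ≤
      C * (y ^ (2 * ν.re + 1) * (1 + y ^ 2) ^ (-(s.re + ν.re / 2 + 5 / 4))) := by
  obtain ⟨C, hC, h⟩ := exists_bound_besselEntire ν hc
  refine ⟨C, hC, fun y hy => ?_⟩
  rw [norm_bassetKernel ν s hy]
  refine (mul_le_mul_of_nonneg_left (h y hy.le) (by positivity)).trans (le_of_eq ?_)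
  have : -(s.re + ν.re / 2 + 5 / 4) = -(s.re + 1) + -(ν.re / 2 + 1 / 4) := by ring
  rw [this, Real.rpow_add (by positivity : 0 < 1 + y ^ 2)]
  ring

theorem integrableOn_bassetKernel {c : ℝ} (hc : 0 < c) {ν s : ℂ} (hν : -1 < ν.re)
    (hs : -1 / 2 < (2 * s - ν).re) : IntegrableOn (bassetKernel c ν s) (Set.Ioi 0) := by
  obtain ⟨C, hC, h⟩ := exists_bound_bassetKernel hc ν s
  have h2 : (2 * s - ν).re = 2 * s.re - ν.re := by simp
  refine Integrable.mono' ((integrableOn_rpow_mul_one_add_sq_rpow (p := 2 * ν.re + 1)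
    (q := s.re + ν.re / 2 + 5 / 4) (by linarith) (by linarith)).const_mul C)
    ((continuousOn_bassetKernel c ν s).aestronglyMeasurable measurableSet_Ioi) ?_
  exact (ae_restrict_iff' measurableSet_Ioi).2 (ae_of_all _ fun y hy => h y hy)

/-! ### The Macdonald function: integral representations and recurrence -/

theorem sq_div_four_le_cosh (u : ℝ) : u ^ 2 / 4 ≤ Real.cosh u := by
  rw [← Real.cosh_abs, ← sq_abs, Real.cosh_eq]
  have := Real.quadratic_le_exp_of_nonneg (abs_nonneg u)
  have := Real.exp_pos (-|u|)
  have := abs_nonneg u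
  linarith

/-- The integrand of the two-sided integral representation of `K`. -/
noncomputable def besselKKernel (x : ℝ) (p : ℂ) (u : ℝ) : ℂ :=
  (Real.exp (-x * Real.cosh u) : ℂ) * Complex.exp (p * u)

theorem continuous_besselKKernel (x : ℝ) (p : ℂ) : Continuous (besselKKernel x p) := by
  unfold besselKKernel
  have : Continuous Real.cosh := Real.continuous_cosh
  fun_prop

theorem integrable_besselKKernel {x : ℝ} (hx : 0 < x) (p : ℂ) :
    Integrable (besselKKernel x p) := by
  have h := integrable_cexp_quadratic (b := ((x / 4 : ℝ) : ℂ))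
    (by rw [Complex.ofReal_re]; positivity) p 0
  refine Integrable.mono h (continuous_besselKKernel x p).aestronglyMeasurable
    (ae_of_all _ fun u => ?_)
  rw [besselKKernel, Complex.ofReal_exp, ← Complex.exp_add, Complex.norm_exp, Complex.norm_exp, Real.exp_le_exp]
  have := mul_le_mul_of_nonneg_left (sq_div_four_le_cosh u) hx.le
  have e1 : (((-x * Real.cosh u : ℝ) : ℂ) + p * u).re = -x * Real.cosh u + p.re * u := by
    rw [Complex.add_re, Complex.ofReal_re, Complex.re_mul_ofReal]
  have e2 : (-((x / 4 : ℝ) : ℂ) * (u : ℂ) ^ 2 + p * u + 0).re = -(x / 4) * u ^ 2 + p.re * u := by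
    rw [add_zero, Complex.add_re, Complex.re_mul_ofReal, ← Complex.ofReal_neg,
      ← Complex.ofReal_pow, ← Complex.ofReal_mul, Complex.ofReal_re]
  rw [e1, e2]
  linarith

theorem besselKKernel_neg (x : ℝ) (p : ℂ) (u : ℝ) :
    besselKKernel x p (-u) = besselKKernel x (-p) u := by
  simp [besselKKernel]

theorem integral_besselKKernel {x : ℝ} (hx : 0 < x) (p : ℂ) :
    ∫ u : ℝ, besselKKernel x p u = 2 * besselK p x := by
  have hi := integrable_besselKKernel hx p
  have hi' := integrable_besselKKernel hx (-p)
  rw [← intervalIntegral.integral_Iic_add_Ioi (b := 0) hi.integrableOn hi.integrableOn,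
    ← neg_zero, ← integral_comp_neg_Ioi, neg_zero]
  simp only [besselKKernel_neg]
  rw [← integral_add hi'.integrableOn hi.integrableOn, besselK, ← integral_const_mul]
  refine integral_congr_ae (ae_of_all _ fun u => ?_)
  simp only [besselKKernel, Complex.cosh]
  rw [neg_mul p]
  ring

/-- The derivative of `exp(-x cosh u + p u)` integrates to zero over the line; writing `sinh u`
through exponentials shifts the order by `±1`. -/
theorem besselK_recurrence {x : ℝ} (hx : 0 < x) (p : ℂ) :
    x * besselK (p + 1) x = x * besselK (p - 1) x + 2 * p * besselK p x := by
  have hd : ∀ u : ℝ, HasDerivAt (besselKKernel x p)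
      (p * besselKKernel x p u -
        (x / 2 * besselKKernel x (p + 1) u - x / 2 * besselKKernel x (p - 1) u)) u := by
    intro u
    have h1 : HasDerivAt (fun u : ℝ => (Real.exp (-x * Real.cosh u) : ℂ))
        ((Real.exp (-x * Real.cosh u) * (-x * Real.sinh u) : ℝ) : ℂ) u :=
      (((Real.hasDerivAt_cosh u).const_mul (-x)).exp).ofReal_comp
    have h2 : HasDerivAt (fun u : ℝ => Complex.exp (p * u)) (Complex.exp (p * u) * p) u := by
      have : HasDerivAt (fun z : ℂ => Complex.exp (p * z)) (Complex.exp (p * u) * p) (u : ℂ) := by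
        simpa using ((hasDerivAt_id (u : ℂ)).const_mul p).cexp
      exact this.comp_ofReal
    refine (h1.mul h2).congr_deriv ?_
    have e1 : Complex.exp ((p + 1) * u) = Complex.exp (p * u) * Complex.exp u := by
      rw [← Complex.exp_add]; ring_nf
    have e2 : Complex.exp ((p - 1) * u) = Complex.exp (p * u) * Complex.exp (-u) := by
      rw [← Complex.exp_add]; ring_nf
    simp only [besselKKernel]
    rw [e1, e2, Complex.ofReal_mul, Complex.ofReal_mul, Complex.ofReal_sinh, Complex.sinh]
    push_cast
    ring
  have hi := integrable_besselKKernel hx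
  have hA : Integrable fun u => (x : ℂ) / 2 * besselKKernel x (p + 1) u := (hi _).const_mul _
  have hB : Integrable fun u => (x : ℂ) / 2 * besselKKernel x (p - 1) u := (hi _).const_mul _
  have hAB : Integrable fun u =>
      (x : ℂ) / 2 * besselKKernel x (p + 1) u - x / 2 * besselKKernel x (p - 1) u := hA.sub hB
  have h0 := integral_eq_zero_of_hasDerivAt_of_integrable hd (((hi p).const_mul p).sub hAB) (hi p)
  rw [integral_sub ((hi p).const_mul p) hAB, integral_sub hA hB,
    integral_const_mul, integral_const_mul, integral_const_mul, integral_besselKKernel hx,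
    integral_besselKKernel hx, integral_besselKKernel hx] at h0
  linear_combination -h0

/-- The substitution `x = z eᵘ` turns `x + z²/x` into `2z cosh u`. -/
theorem integral_cpow_mul_exp_neg_sub_div {z : ℝ} (hz : 0 < z) (p : ℂ) :
    ∫ x in Set.Ioi (0 : ℝ), (x : ℂ) ^ (p - 1) * (Real.exp (-x - z ^ 2 / x) : ℂ) =
      2 * (z : ℂ) ^ p * besselK p (2 * z) := by
  have himg : (fun u : ℝ => z * Real.exp u) '' Set.univ = Set.Ioi 0 := by
    rw [Set.image_univ]
    ext x
    constructor
    · rintro ⟨u, rfl⟩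
      exact mul_pos hz (Real.exp_pos u)
    · intro hx
      refine ⟨Real.log (x / z), ?_⟩
      simp only
      rw [Real.exp_log (div_pos hx hz)]
      field_simp
  have hinj : Set.InjOn (fun u : ℝ => z * Real.exp u) Set.univ := fun u _ v _ h =>
    Real.exp_injective (mul_left_cancel₀ hz.ne' h)
  rw [← himg, integral_image_eq_integral_abs_deriv_smul MeasurableSet.univ
    (fun u _ => ((Real.hasDerivAt_exp u).const_mul z).hasDerivWithinAt) hinj,
    Measure.restrict_univ, mul_right_comm, ← integral_besselKKernel (by positivity),
    ← integral_mul_const]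
  refine integral_congr_ae (ae_of_all _ fun u => ?_)
  have hz' : (z : ℂ) ≠ 0 := Complex.ofReal_ne_zero.2 hz.ne'
  have hu := Real.exp_pos u
  simp only [besselKKernel]
  rw [abs_of_pos (by positivity), Complex.real_smul, Complex.ofReal_mul,
    Complex.mul_cpow_ofReal_nonneg hz.le hu.le]
  have e1 : -(z * Real.exp u) - z ^ 2 / (z * Real.exp u) = -(2 * z) * Real.cosh u := by
    rw [Real.cosh_eq, Real.exp_neg]
    field_simp
    ring
  have e2 : ((Real.exp u : ℝ) : ℂ) ^ (p - 1) = Complex.exp (p * u) / Real.exp u := by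
    rw [Complex.cpow_sub _ _ (Complex.ofReal_ne_zero.2 hu.ne'), Complex.cpow_one,
      Complex.cpow_def_of_ne_zero (Complex.ofReal_ne_zero.2 hu.ne'), ← Complex.ofReal_log hu.le,
      Real.log_exp, mul_comm p]
  have hu' : ((Real.exp u : ℝ) : ℂ) ≠ 0 := Complex.ofReal_ne_zero.2 hu.ne'
  rw [e1, e2, Complex.cpow_sub _ _ hz', Complex.cpow_one]
  field_simp

/-! ### Weber's integral and the absolutely convergent Basset integral -/

theorem integral_cpow_mul_exp_neg_mul_sq {a : ℂ} (ha : 0 < a.re) {X : ℝ} (hX : 0 < X) :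
    ∫ y in Set.Ioi (0 : ℝ), (y : ℂ) ^ (2 * a - 1) * (Real.exp (-X * y ^ 2) : ℂ) =
      Complex.Gamma a / (2 * (X : ℂ) ^ a) := by
  have h := integral_comp_rpow_Ioi_of_pos
    (g := fun w : ℝ => (w : ℂ) ^ (a - 1) * Complex.exp (-(X * w))) (p := 2) two_pos
  rw [Complex.integral_cpow_mul_exp_neg_mul_Ioi ha hX] at h
  have h2 : ∫ y in Set.Ioi (0 : ℝ), (y : ℂ) ^ (2 * a - 1) * (Real.exp (-X * y ^ 2) : ℂ) =
      1 / 2 * ∫ y in Set.Ioi (0 : ℝ), (2 * y ^ ((2 : ℝ) - 1)) •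
        (((y ^ (2 : ℝ) : ℝ) : ℂ) ^ (a - 1) * Complex.exp (-(X * (y ^ (2 : ℝ) : ℝ)))) := by
    rw [← integral_const_mul]
    refine setIntegral_congr_fun measurableSet_Ioi fun y hy => ?_
    have hy : 0 < y := hy
    have hy' : (y : ℂ) ≠ 0 := Complex.ofReal_ne_zero.2 hy.ne'
    have e1 : ((y ^ 2 : ℝ) : ℂ) ^ (a - 1) = (y : ℂ) ^ (a - 1) * (y : ℂ) ^ (a - 1) := by
      rw [pow_two, Complex.ofReal_mul, Complex.mul_cpow_ofReal_nonneg hy.le hy.le]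
    have e2 : (y : ℂ) ^ (2 * a - 1) = (y : ℂ) ^ (a - 1) * (y : ℂ) ^ (a - 1) * y := by
      rw [← Complex.cpow_add _ _ hy']
      nth_rewrite 3 [← Complex.cpow_one (y : ℂ)]
      rw [← Complex.cpow_add _ _ hy']
      ring_nf
    simp only [Real.rpow_two]
    rw [e1, e2, show (2 : ℝ) - 1 = 1 by norm_num, Real.rpow_one, Complex.real_smul]
    push_cast
    rw [neg_mul]
    ring
  rw [h2, h, one_div (X : ℂ), Complex.inv_cpow]
  · field_simp
  · rw [Complex.arg_ofReal_of_nonneg hX.le]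
    exact Real.pi_pos.ne

/-- The left side is nonincreasing in `k`, since `Re(ν+k+1) ≤ ‖ν+k+1‖`. This bounds the real Gammas
that arise on integrating absolute values in Weber's integral, where the coefficients contain
complex ones. -/
theorem Gamma_re_div_norm_Gamma_le {ν : ℂ} (hν : -1 < ν.re) (k : ℕ) :
    Real.Gamma (ν.re + k + 1) * ‖(Complex.Gamma (ν + k + 1))⁻¹‖ ≤
      Real.Gamma (ν.re + 1) * ‖(Complex.Gamma (ν + 1))⁻¹‖ := by
  induction k with
  | zero => simp
  | succ k ih =>
    refine le_trans ?_ ih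
    have hp : 0 < ν.re + k + 1 := by
      have : (0 : ℝ) ≤ k := k.cast_nonneg
      linarith
    have e1 : ν.re + (k + 1 : ℕ) + 1 = ν.re + k + 1 + 1 := by push_cast; ring
    have e2 : ν + (k + 1 : ℕ) + 1 = ν + k + 1 + 1 := by push_cast; ring
    rw [e1, e2, Real.Gamma_add_one hp.ne', inv_Gamma_add_one (ν + k + 1), norm_mul]
    have h1 : ν.re + k + 1 ≤ ‖ν + k + 1‖ := by
      refine le_trans (le_of_eq ?_) (Complex.re_le_norm _)
      simp
    have h2 := (Real.Gamma_pos_of_pos hp).le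
    calc (ν.re + k + 1) * Real.Gamma (ν.re + k + 1) * ‖(Complex.Gamma (ν + k + 1 + 1))⁻¹‖
        ≤ ‖ν + k + 1‖ * Real.Gamma (ν.re + k + 1) * ‖(Complex.Gamma (ν + k + 1 + 1))⁻¹‖ := by
          gcongr
      _ = _ := by ring

theorem integral_rpow_mul_exp_neg_mul_sq {a : ℝ} (ha : 0 < a) {X : ℝ} (hX : 0 < X) :
    ∫ y in Set.Ioi (0 : ℝ), y ^ (2 * a - 1) * Real.exp (-X * y ^ 2) =
      Real.Gamma a / (2 * X ^ a) := by
  have h := integral_rpow_mul_exp_neg_mul_rpow (p := 2) (q := 2 * a - 1) two_pos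
    (by linarith) hX
  simp only [Real.rpow_two] at h
  rw [h, show (2 * a - 1 + 1) / 2 = a by ring, show -(2 * a - 1 + 1) / 2 = -a by ring,
    Real.rpow_neg hX.le]
  field_simp

/-- Integrating the series termwise, each Gaussian moment `Γ(ν+k+1)` cancels the Gamma in the
coefficient and leaves the exponential series of `-c²/X`. -/
theorem integral_cpow_mul_exp_mul_besselEntire {ν : ℂ} (hν : -1 < ν.re) (c : ℝ) {X : ℝ}
    (hX : 0 < X) :
    ∫ y in Set.Ioi (0 : ℝ), (y : ℂ) ^ (2 * ν + 1) * (Real.exp (-X * y ^ 2) : ℂ) *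
      besselEntire ν (-((c * y : ℝ) : ℂ) ^ 2) =
      (Real.exp (-c ^ 2 / X) : ℂ) / (2 * (X : ℂ) ^ (ν + 1)) := by
  have hX' : (X : ℂ) ≠ 0 := Complex.ofReal_ne_zero.2 hX.ne'
  have hre : ∀ k : ℕ, 0 < ν.re + k + 1 := fun k => by
    have : (0 : ℝ) ≤ k := k.cast_nonneg
    linarith
  set F : ℕ → ℝ → ℂ := fun k y => (-c ^ 2 : ℂ) ^ k / ((k.factorial : ℂ) *
    Complex.Gamma (ν + k + 1)) *
      ((y : ℂ) ^ (2 * (ν + k + 1) - 1) * (Real.exp (-X * y ^ 2) : ℂ)) with hF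
  have hFn : ∀ k, ∀ y ∈ Set.Ioi (0 : ℝ), ‖F k y‖ = ‖(-c ^ 2 : ℂ) ^ k / ((k.factorial : ℂ) *
      Complex.Gamma (ν + k + 1))‖ *
      (y ^ (2 * (ν.re + k + 1) - 1) * Real.exp (-X * y ^ 2)) := by
    intro k y hy
    rw [hF, norm_mul, norm_mul, Complex.norm_cpow_eq_rpow_re_of_pos hy, Complex.norm_real,
      Real.norm_of_nonneg (Real.exp_pos _).le]
    simp
  have hFi : ∀ k, IntegrableOn (F k) (Set.Ioi 0) := by
    intro k
    refine Integrable.mono' ((integrableOn_rpow_mul_exp_neg_mul_sq hX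
      (s := 2 * (ν.re + k + 1) - 1) (by linarith [hre k])).const_mul ‖(-c ^ 2 : ℂ) ^ k /
        ((k.factorial : ℂ) * Complex.Gamma (ν + k + 1))‖) ?_ ?_
    · refine ContinuousOn.aestronglyMeasurable ?_ measurableSet_Ioi
      refine continuousOn_const.mul ((continuousOn_ofReal_cpow _).mul ?_)
      exact Continuous.continuousOn (by fun_prop)
    · exact (ae_restrict_iff' measurableSet_Ioi).2 (ae_of_all _ fun y hy => (hFn k y hy).le)
  have hFint : ∀ k, ∫ y in Set.Ioi (0 : ℝ), F k y =
      ((-c ^ 2 / X : ℝ) : ℂ) ^ k / k.factorial * (1 / (2 * (X : ℂ) ^ (ν + 1))) := by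
    intro k
    have hk : 0 < (ν + k + 1).re := by simpa using hre k
    rw [hF, integral_const_mul, integral_cpow_mul_exp_neg_mul_sq hk hX]
    have hG := Complex.Gamma_ne_zero_of_re_pos hk
    have hf : (k.factorial : ℂ) ≠ 0 := Nat.cast_ne_zero.2 k.factorial_ne_zero
    have hXν : (X : ℂ) ^ (ν + 1) ≠ 0 := by simp [Complex.cpow_eq_zero_iff, hX']
    rw [show ν + k + 1 = ν + 1 + k by ring, Complex.cpow_add _ _ hX', Complex.cpow_natCast]
    rw [show ν + k + 1 = ν + 1 + k by ring] at hG
    push_cast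
    rw [div_pow]
    field_simp
  have hsum : Summable fun k => ∫ y in Set.Ioi (0 : ℝ), ‖F k y‖ := by
    set D : ℝ := Real.Gamma (ν.re + 1) * ‖(Complex.Gamma (ν + 1))⁻¹‖ with hD
    refine Summable.of_nonneg_of_le (fun k => integral_nonneg fun _ => norm_nonneg _)
      (fun k => ?_) ((Real.summable_pow_div_factorial (c ^ 2 / X)).mul_right
        (D / (2 * X ^ (ν.re + 1))))
    rw [setIntegral_congr_fun measurableSet_Ioi (hFn k), integral_const_mul,
      integral_rpow_mul_exp_neg_mul_sq (hre k) hX]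
    have h1 := Gamma_re_div_norm_Gamma_le hν k
    rw [← hD] at h1
    have e : X ^ (ν.re + k + 1) = X ^ (ν.re + 1) * X ^ k := by
      rw [← Real.rpow_natCast X k, ← Real.rpow_add hX]; ring_nf
    rw [e, norm_div, norm_mul, norm_pow, norm_neg, norm_pow, Complex.norm_real, Real.norm_eq_abs,
      sq_abs, Complex.norm_natCast]
    rw [norm_inv] at h1
    calc (c ^ 2) ^ k / (k.factorial * ‖Complex.Gamma (ν + k + 1)‖) *
          (Real.Gamma (ν.re + k + 1) / (2 * (X ^ (ν.re + 1) * X ^ k)))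
        = (c ^ 2 / X) ^ k / k.factorial * ((Real.Gamma (ν.re + k + 1) *
          ‖Complex.Gamma (ν + k + 1)‖⁻¹) / (2 * X ^ (ν.re + 1))) := by
          rw [div_pow]
          simp only [div_eq_mul_inv, mul_inv]
          ring
      _ ≤ _ := by gcongr
  have hmain := hasSum_integral_of_summable_integral_norm hFi hsum
  have hexp : HasSum (fun k => ((-c ^ 2 / X : ℝ) : ℂ) ^ k / k.factorial *
      (1 / (2 * (X : ℂ) ^ (ν + 1))))
      ((Real.exp (-c ^ 2 / X) : ℂ) * (1 / (2 * (X : ℂ) ^ (ν + 1)))) := by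
    have := NormedSpace.expSeries_div_hasSum_exp (((-c ^ 2 / X : ℝ) : ℂ))
    rw [← Complex.exp_eq_exp_ℂ, ← Complex.ofReal_exp] at this
    exact this.mul_right _
  simp only [hFint] at hmain
  have hval := hmain.unique hexp
  rw [mul_one_div] at hval
  rw [← hval]
  refine setIntegral_congr_fun measurableSet_Ioi fun y hy => ?_
  have hy' : (y : ℂ) ≠ 0 := Complex.ofReal_ne_zero.2 (ne_of_gt hy)
  simp only [besselEntire, hF]
  rw [← tsum_mul_left]
  refine tsum_congr fun k => ?_
  have e : (y : ℂ) ^ (2 * (ν + k + 1) - 1) = (y : ℂ) ^ (2 * ν + 1) * (y : ℂ) ^ (2 * k) := by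
    rw [← Complex.cpow_natCast _ (2 * k), ← Complex.cpow_add _ _ hy']
    push_cast; ring_nf
  have e' : (-((c * y : ℝ) : ℂ) ^ 2) ^ k = (-c ^ 2 : ℂ) ^ k * (y : ℂ) ^ (2 * k) := by
    push_cast
    rw [pow_mul, ← mul_pow]
    ring
  rw [e, e']
  ring

/-- Write `Γ(s+1) Y^(-(s+1))` as `∫ x^s exp(-Yx) dx` and exchange integrals. The `y`-integral is
Weber's, and the remaining `x`-integral represents `K_{s-ν}(2c)`. -/
theorem integral_bassetKernel {c : ℝ} (hc : 0 < c) {ν s : ℂ} (hν : -1 < ν.re) (hs : -1 < s.re)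
    (hsν : -1 / 2 < (2 * s - ν).re) :
    ∫ y in Set.Ioi (0 : ℝ), bassetKernel c ν s y =
      (c : ℂ) ^ (s - ν) * besselK (s - ν) (2 * c) / Complex.Gamma (s + 1) := by
  have hs1 : 0 < (s + 1).re := by simpa using by linarith
  set G : ℝ → ℝ → ℂ := fun x y => (x : ℂ) ^ (s + 1 - 1) * Complex.exp (-((1 + y ^ 2 : ℝ) * x)) *
    ((y : ℂ) ^ (2 * ν + 1) * besselEntire ν (-((c * y : ℝ) : ℂ) ^ 2)) with hG
  have hGx : ∀ y ∈ Set.Ioi (0 : ℝ), ∫ x in Set.Ioi (0 : ℝ), G x y =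
      Complex.Gamma (s + 1) * bassetKernel c ν s y := by
    intro y hy
    have hpos : 0 < 1 + y ^ 2 := by positivity
    simp only [hG]
    rw [integral_mul_const, Complex.integral_cpow_mul_exp_neg_mul_Ioi hs1 hpos, one_div,
      Complex.inv_cpow _ _ (by rw [Complex.arg_ofReal_of_nonneg hpos.le]; exact Real.pi_pos.ne),
      ← Complex.cpow_neg, bassetKernel]
    ring
  have hnorm : ∀ x ∈ Set.Ioi (0 : ℝ), ∀ y ∈ Set.Ioi (0 : ℝ), ‖G x y‖ =
      x ^ (s.re + 1 - 1) * Real.exp (-((1 + y ^ 2) * x)) *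
      (y ^ (2 * ν.re + 1) * ‖besselEntire ν (-((c * y : ℝ) : ℂ) ^ 2)‖) := by
    intro x hx y hy
    simp only [hG]
    rw [norm_mul, norm_mul, norm_mul, Complex.norm_cpow_eq_rpow_re_of_pos hx,
      Complex.norm_cpow_eq_rpow_re_of_pos hy, Complex.norm_exp, ← Complex.ofReal_mul,
      ← Complex.ofReal_neg, Complex.ofReal_re]
    simp
  have hmeas : AEStronglyMeasurable (Function.uncurry G)
      ((volume.restrict (Set.Ioi 0)).prod (volume.restrict (Set.Ioi 0))) := by
    rw [Measure.prod_restrict]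
    refine ContinuousOn.aestronglyMeasurable ?_ (measurableSet_Ioi.prod measurableSet_Ioi)
    refine ContinuousOn.mul (ContinuousOn.mul ?_ ?_) ?_
    · exact (continuousOn_ofReal_cpow _).comp continuousOn_fst fun p hp => hp.1
    · exact Continuous.continuousOn (by fun_prop)
    · exact ((continuousOn_ofReal_cpow _).mul
        (continuous_besselEntire_neg_sq ν c).continuousOn).comp continuousOn_snd fun p hp => hp.2
  have hint : Integrable (Function.uncurry G)
      ((volume.restrict (Set.Ioi 0)).prod (volume.restrict (Set.Ioi 0))) := by
    -- Taking absolute values and integrating in `x` first gives back a constant times the norm of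
    -- the Basset kernel, whose integrability needs `Re(2s - ν) > -1/2`.
    rw [integrable_prod_iff' hmeas]
    constructor
    · refine (ae_restrict_iff' measurableSet_Ioi).2 (ae_of_all _ fun y hy => ?_)
      have hpos : 0 < 1 + y ^ 2 := by positivity
      have hg : IntegrableOn (fun x : ℝ => x ^ (s.re + 1 - 1) * Real.exp (-((1 + y ^ 2) * x)) *
          (y ^ (2 * ν.re + 1) * ‖besselEntire ν (-((c * y : ℝ) : ℂ) ^ 2)‖)) (Set.Ioi 0) := by
        refine Integrable.mul_const ?_ _
        have := integrableOn_rpow_mul_exp_neg_mul_rpow (p := 1) (s := s.re + 1 - 1)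
          (b := 1 + y ^ 2) (by linarith) one_pos hpos
        simp only [neg_mul, Real.rpow_one] at this
        exact this
      refine Integrable.mono' hg ?_ ?_
      · refine ContinuousOn.aestronglyMeasurable ?_ measurableSet_Ioi
        simp only [Function.uncurry, hG]
        refine ((continuousOn_ofReal_cpow _).mul ?_).mul continuousOn_const
        exact Continuous.continuousOn (by fun_prop)
      · exact (ae_restrict_iff' measurableSet_Ioi).2 (ae_of_all _ fun x hx => (hnorm x hx y hy).le)
    · have hb := ((integrableOn_bassetKernel hc hν hsν).norm).const_mul (Real.Gamma (s.re + 1))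
      refine hb.congr ((ae_restrict_iff' measurableSet_Ioi).2 (ae_of_all _ fun y hy => ?_))
      have hpos : 0 < 1 + y ^ 2 := by positivity
      simp only [Function.uncurry]
      rw [setIntegral_congr_fun measurableSet_Ioi (fun x hx => hnorm x hx y hy),
        integral_mul_const, Real.integral_rpow_mul_exp_neg_mul_Ioi (by linarith) hpos,
        norm_bassetKernel ν s hy, one_div, Real.inv_rpow hpos.le, ← Real.rpow_neg hpos.le]
      ring
  have hswap := integral_integral_swap hint
  rw [setIntegral_congr_fun measurableSet_Ioi hGx, integral_const_mul] at hswap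
  have hGy : ∀ x ∈ Set.Ioi (0 : ℝ), ∫ y in Set.Ioi (0 : ℝ), G x y =
      1 / 2 * ((x : ℂ) ^ (s - ν - 1) * (Real.exp (-x - c ^ 2 / x) : ℂ)) := by
    intro x hx
    have hx' : (x : ℂ) ≠ 0 := Complex.ofReal_ne_zero.2 (ne_of_gt hx)
    have e : ∀ y : ℝ, G x y = (x : ℂ) ^ s * (Real.exp (-x) : ℂ) *
        ((y : ℂ) ^ (2 * ν + 1) * (Real.exp (-x * y ^ 2) : ℂ) *
          besselEntire ν (-((c * y : ℝ) : ℂ) ^ 2)) := by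
      intro y
      have : Complex.exp (-((1 + y ^ 2 : ℝ) * x)) =
          (Real.exp (-x) : ℂ) * (Real.exp (-x * y ^ 2) : ℂ) := by
        rw [← Complex.ofReal_mul (Real.exp _), ← Real.exp_add, ← Complex.ofReal_mul,
          ← Complex.ofReal_neg, ← Complex.ofReal_exp]
        ring_nf
      simp only [hG]
      rw [this, add_sub_cancel_right]
      ring
    simp only [e]
    rw [integral_const_mul, integral_cpow_mul_exp_mul_besselEntire hν c hx,
      show s - ν - 1 = s - (ν + 1) by ring, Complex.cpow_sub _ _ hx',
      show -x - c ^ 2 / x = -x + -c ^ 2 / x by ring, Real.exp_add, Complex.ofReal_mul]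
    have hXν : (x : ℂ) ^ (ν + 1) ≠ 0 := by simp [Complex.cpow_eq_zero_iff, hx']
    field_simp
  rw [setIntegral_congr_fun measurableSet_Ioi hGy, integral_const_mul,
    integral_cpow_mul_exp_neg_sub_div hc] at hswap
  rw [eq_div_iff (Complex.Gamma_ne_zero_of_re_pos hs1)]
  linear_combination -hswap

/-! ### Vandermonde convolution of reciprocal Gammas -/

/-- Pascal's rule for binomially weighted sums. -/
theorem sum_choose_succ_mul (f : ℕ → ℂ) (n : ℕ) :
    ∑ m ∈ Finset.range (n + 2), ((n + 1).choose m : ℂ) * f m =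
      ∑ m ∈ Finset.range (n + 1), (n.choose m : ℂ) * f m +
      ∑ m ∈ Finset.range (n + 1), (n.choose m : ℂ) * f (m + 1) := by
  rw [Finset.sum_range_succ']
  simp only [Nat.choose_succ_succ, Nat.cast_add, add_mul, Finset.sum_add_distrib]
  have : ∑ m ∈ Finset.range (n + 1), (n.choose m : ℂ) * f m =
      ∑ m ∈ Finset.range (n + 1), (n.choose (m + 1) : ℂ) * f (m + 1) +
        (n.choose 0 : ℂ) * f 0 := by
    rw [← Finset.sum_range_succ' (fun m => (n.choose m : ℂ) * f m), Finset.sum_range_succ _ (n + 1)]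
    simp
  rw [this]
  simp
  ring

/-- By Pascal's rule the sum splits into the cases `(α, β+1)` and `(α+1, β)`, which share the same
Pochhammer value. Their leftover factors add up to `(α+m+1) + (β+m+1)`, exactly the next Pochhammer
factor. -/
theorem sum_choose_mul_inv_Gamma (m : ℕ) (α β : ℂ) :
    ∑ j ∈ Finset.range (m + 1), (m.choose j : ℂ) * ((Complex.Gamma (α + j + 1))⁻¹ *
      (Complex.Gamma (β + m - j + 1))⁻¹) =
      (ascPochhammer ℂ m).eval (α + β + m + 1) * ((Complex.Gamma (α + m + 1))⁻¹ *
        (Complex.Gamma (β + m + 1))⁻¹) := by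
  induction m generalizing α β with
  | zero => simp
  | succ m ih =>
    rw [sum_choose_succ_mul]
    have h1 := ih α (β + 1)
    have h2 := ih (α + 1) β
    have e1 : ∀ j : ℕ, β + ((m + 1 : ℕ) : ℂ) - j + 1 = β + 1 + m - j + 1 := fun j => by
      push_cast; ring
    have e2 : ∀ j : ℕ, β + ((m + 1 : ℕ) : ℂ) - ((j + 1 : ℕ) : ℂ) + 1 = β + m - j + 1 := fun j => by
      push_cast; ring
    have e3 : ∀ j : ℕ, α + ((j + 1 : ℕ) : ℂ) + 1 = α + 1 + j + 1 := fun j => by push_cast; ring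
    simp only [e2, e3]
    simp only [e1]
    rw [h1, h2, ascPochhammer_succ_eval, inv_Gamma_add_one (α + m + 1),
      inv_Gamma_add_one (β + m + 1)]
    rw [show α + (β + 1) + m + 1 = α + β + ((m + 1 : ℕ) : ℂ) + 1 by push_cast; ring,
      show α + 1 + β + m + 1 = α + β + ((m + 1 : ℕ) : ℂ) + 1 by push_cast; ring,
      show α + 1 + m + 1 = α + m + 1 + 1 by ring, show β + 1 + m + 1 = β + m + 1 + 1 by ring,
      show β + ((m + 1 : ℕ) : ℂ) + 1 = β + m + 1 + 1 by push_cast; ring]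
    push_cast
    ring

/-! ### Collapse of binomial sums of Macdonald functions -/

/-- Binomial sum of `K`-Bessel functions with shifted orders. -/
noncomputable def besselKSum (n : ℕ) (z : ℝ) (p μ : ℂ) : ℂ :=
  ∑ m ∈ Finset.range (n + 1), (n.choose m : ℂ) *
    ((-z : ℂ) ^ m * besselK (p + m) (2 * z) * (Complex.Gamma (μ + m + 1))⁻¹)

theorem besselKSum_succ (n : ℕ) (z : ℝ) (p μ : ℂ) :
    besselKSum (n + 1) z p μ = besselKSum n z p μ - z * besselKSum n z (p + 1) (μ + 1) := by
  rw [besselKSum, sum_choose_succ_mul, besselKSum, besselKSum, sub_eq_add_neg, ← neg_mul,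
    Finset.mul_sum]
  congr 1
  refine Finset.sum_congr rfl fun m _ => ?_
  rw [show p + ((m + 1 : ℕ) : ℂ) = p + 1 + m by push_cast; ring,
    show μ + ((m + 1 : ℕ) : ℂ) + 1 = μ + 1 + m + 1 by push_cast; ring]
  ring

theorem besselK_two_mul_recurrence {z : ℝ} (hz : 0 < z) (p : ℂ) :
    z * besselK (p + 1) (2 * z) = z * besselK (p - 1) (2 * z) + p * besselK p (2 * z) := by
  have := besselK_recurrence (by positivity : 0 < 2 * z) p
  push_cast at this
  linear_combination this / 2

theorem besselKSum_order_sub {z : ℝ} (hz : 0 < z) (n : ℕ) (p μ : ℂ) :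
    z * besselKSum n z (p + 1) (μ + 1) =
      z * besselKSum n z (p - 1) (μ + 1) + (p - μ - 1) * besselKSum n z p (μ + 1) +
        besselKSum n z p μ := by
  simp only [besselKSum, Finset.mul_sum, ← Finset.sum_add_distrib]
  refine Finset.sum_congr rfl fun m _ => ?_
  have h := besselK_two_mul_recurrence hz (p + m)
  rw [show p + m + 1 = p + 1 + m by ring, show p + m - 1 = p - 1 + m by ring] at h
  rw [inv_Gamma_add_one (μ + m + 1), show μ + 1 + m + 1 = μ + m + 1 + 1 by ring]
  linear_combination ((n.choose m : ℂ) * (-z : ℂ) ^ m * (Complex.Gamma (μ + m + 1 + 1))⁻¹) * h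

/-- The second identity, one order lower, is carried along because the induction step for the first
needs it at `μ + 1`. -/
theorem besselKSum_eq_aux {z : ℝ} (hz : 0 < z) (n : ℕ) : ∀ μ : ℂ,
    besselKSum n z (μ + n) μ =
      (-z : ℂ) ^ n * besselK μ (2 * z) * (Complex.Gamma (μ + n + 1))⁻¹ ∧
    z * besselKSum n z (μ + n - 1) μ =
      (-z : ℂ) ^ n * (z * besselK (μ - 1) (2 * z) - n * besselK μ (2 * z)) *
        (Complex.Gamma (μ + n + 1))⁻¹ := by
  induction n with
  | zero => intro μ; simp [besselKSum]; ring
  | succ n ih =>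
    intro μ
    obtain ⟨a0, b0⟩ := ih μ
    obtain ⟨a1, b1⟩ := ih (μ + 1)
    have hr := besselK_two_mul_recurrence hz μ
    have hG := inv_Gamma_add_one (μ + n + 1)
    -- At this order the middle coefficient `p - μ - 1` is `n`, and the last term cancels the first
    -- term of Pascal's rule `s1`.
    have o := besselKSum_order_sub hz n (μ + n + 1) μ
    have s1 := besselKSum_succ n z (μ + n + 1) μ
    have s2 := besselKSum_succ n z (μ + n) μ
    rw [show μ + 1 + n = μ + n + 1 by ring, show μ + n + 1 + 1 = μ + n + 2 by ring] at a1
    rw [show μ + 1 + n = μ + n + 1 by ring, show μ + n + 1 + 1 = μ + n + 2 by ring,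
      add_sub_cancel_right] at b1
    rw [add_sub_cancel_right] at o b1
    rw [show μ + n + 1 + 1 = μ + n + 2 by ring] at o s1 hG
    rw [show μ + ((n + 1 : ℕ) : ℂ) = μ + n + 1 by push_cast; ring,
      show μ + n + 1 + 1 = μ + n + 2 by ring, add_sub_cancel_right]
    rw [hG] at a0
    push_cast
    constructor
    · rw [s1]
      linear_combination -o - b1 - n * a1
    · rw [s2]
      linear_combination z * a0 - (z : ℂ) ^ 2 * a1 +
        z * (-z : ℂ) ^ n * (Complex.Gamma (μ + n + 2))⁻¹ * (-hr)

theorem besselKSum_eq {z : ℝ} (hz : 0 < z) (n : ℕ) (μ : ℂ) :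
    besselKSum n z (μ + n) μ =
      (-z : ℂ) ^ n * besselK μ (2 * z) * (Complex.Gamma (μ + n + 1))⁻¹ :=
  (besselKSum_eq_aux hz n μ).1

/-! ### Coefficients of the product of the two series as polynomials in `Y` -/

theorem choose_div_factorial_mul_factorial {n m j : ℕ} (hj : j ≤ m) (hm : m ≤ n) :
    ((n - j).choose (m - j) : ℂ) / ((j.factorial : ℂ) * ((n - j).factorial : ℂ)) =
      (n.choose m : ℂ) * (m.choose j : ℂ) / n.factorial := by
  have h1 : (n.choose m : ℂ) * m.choose j = n.choose j * (n - j).choose (m - j) := by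
    exact_mod_cast Nat.choose_mul hj
  have h2 : (n.choose j : ℂ) * j.factorial * (n - j).factorial = n.factorial := by
    exact_mod_cast Nat.choose_mul_factorial_mul_factorial (hj.trans hm)
  have f1 : (j.factorial : ℂ) ≠ 0 := Nat.cast_ne_zero.2 j.factorial_ne_zero
  have f2 : ((n - j).factorial : ℂ) ≠ 0 := Nat.cast_ne_zero.2 (n - j).factorial_ne_zero
  have f3 : (n.factorial : ℂ) ≠ 0 := Nat.cast_ne_zero.2 n.factorial_ne_zero
  rw [div_eq_div_iff (mul_ne_zero f1 f2) f3]
  linear_combination (-((n - j).choose (m - j) : ℂ)) * h2 -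
    ((j.factorial : ℂ) * (n - j).factorial) * h1

/-- The coefficient of `(-1)ᵐ Yⁿ⁻ᵐ` in the polynomial of `sum_antidiagonal_sub_one_pow`. -/
noncomputable def jacobiCoeff (μ ν : ℂ) (n m : ℕ) : ℂ :=
  (n.choose m : ℂ) / n.factorial * ((ascPochhammer ℂ m).eval (μ + ν + n + 1) *
    ((Complex.Gamma (μ + m + 1))⁻¹ * (Complex.Gamma (ν + n + 1))⁻¹))

theorem sum_antidiagonal_sub_one_pow (μ ν Y : ℂ) (n : ℕ) :
    ∑ p ∈ Finset.HasAntidiagonal.antidiagonal n, (-1) ^ p.1 / ((p.1.factorial : ℂ) * Complex.Gamma (μ + p.1 + 1)) *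
      ((Y - 1) ^ p.2 / ((p.2.factorial : ℂ) * Complex.Gamma (ν + p.2 + 1))) =
      ∑ m ∈ Finset.range (n + 1), (-1) ^ m * jacobiCoeff μ ν n m * Y ^ (n - m) := by
  rw [Finset.Nat.sum_antidiagonal_eq_sum_range_succ_mk]
  -- The index is `m = j + i`, with `i` the exponent of `-1` in the binomial expansion. The last
  -- Gamma argument is left as `ν + n - m + m - j + 1` to match Vandermonde with `β = ν + n - m`.
  set t : ℕ → ℕ → ℂ := fun j m => (-1) ^ m * Y ^ (n - m) * ((n.choose m : ℂ) / n.factorial) *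
    ((m.choose j : ℂ) * ((Complex.Gamma (μ + j + 1))⁻¹ *
      (Complex.Gamma (ν + n - m + m - j + 1))⁻¹)) with ht
  have h1 : ∀ j ∈ Finset.range (n + 1),
      (-1) ^ j / ((j.factorial : ℂ) * Complex.Gamma (μ + j + 1)) *
      ((Y - 1) ^ (n - j) / (((n - j).factorial : ℂ) * Complex.Gamma (ν + (n - j : ℕ) + 1))) =
      ∑ m ∈ Finset.Ico j (n + 1), t j m := by
    intro j hj
    have hj : j ≤ n := Nat.lt_succ_iff.1 (Finset.mem_range.1 hj)
    rw [Finset.sum_Ico_eq_sum_range, Nat.succ_sub hj, sub_eq_neg_add, add_pow, Finset.sum_div,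
      Finset.mul_sum]
    refine Finset.sum_congr rfl fun i hi => ?_
    have hi : i ≤ n - j := Nat.lt_succ_iff.1 (Finset.mem_range.1 hi)
    have hc := choose_div_factorial_mul_factorial (n := n) (m := j + i) (j := j)
      (Nat.le_add_right _ _) (by omega)
    rw [Nat.add_sub_cancel_left] at hc
    have e1 : n - j - i = n - (j + i) := by omega
    have e2 : ν + (n - j : ℕ) + 1 = ν + n - (j + i : ℕ) + (j + i : ℕ) - j + 1 := by
      rw [Nat.cast_sub hj]; ring
    simp only [ht]
    rw [e1, e2, pow_add]
    simp only [div_eq_mul_inv, mul_inv] at hc ⊢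
    linear_combination ((-1) ^ j * (-1) ^ i * Y ^ (n - (j + i)) * (Complex.Gamma (μ + j + 1))⁻¹ *
      (Complex.Gamma (ν + n - (j + i : ℕ) + (j + i : ℕ) - j + 1))⁻¹) * hc
  rw [Finset.sum_congr rfl h1, Finset.sum_comm' (t' := Finset.range (n + 1))
    (s' := fun m => Finset.range (m + 1))
    (fun j m => by simp only [Finset.mem_range, Finset.mem_Ico]; omega)]
  refine Finset.sum_congr rfl fun m _ => ?_
  simp only [ht]
  rw [← Finset.mul_sum, sum_choose_mul_inv_Gamma, jacobiCoeff]
  rw [show μ + (ν + n - m) + m + 1 = μ + ν + n + 1 by ring,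
    show ν + (n : ℂ) - m + m + 1 = ν + n + 1 by ring]
  ring

/-! ### Calculus of improper integrals -/

theorem hasImproperIntegral_of_integrableOn {f : ℝ → ℂ} (hf : IntegrableOn f (Set.Ioi 0)) :
    HasImproperIntegral f (∫ y in Set.Ioi (0 : ℝ), f y) :=
  ⟨fun _ hR => (intervalIntegrable_iff_integrableOn_Ioc_of_le hR.le).2
    (hf.mono_set Set.Ioc_subset_Ioi_self),
    intervalIntegral_tendsto_integral_Ioi 0 hf tendsto_id⟩

theorem HasImproperIntegral.add {f g : ℝ → ℂ} {L M : ℂ} (hf : HasImproperIntegral f L)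
    (hg : HasImproperIntegral g M) : HasImproperIntegral (fun y => f y + g y) (L + M) := by
  refine ⟨fun R hR => (hf.1 R hR).add (hg.1 R hR), (hf.2.add hg.2).congr' ?_⟩
  filter_upwards [eventually_gt_atTop 0] with R hR
  exact (intervalIntegral.integral_add (hf.1 R hR) (hg.1 R hR)).symm

theorem HasImproperIntegral.const_mul {f : ℝ → ℂ} {L : ℂ} (hf : HasImproperIntegral f L) (A : ℂ) :
    HasImproperIntegral (fun y => A * f y) (A * L) := by
  refine ⟨fun R hR => (hf.1 R hR).const_mul A, (hf.2.const_mul A).congr fun R => ?_⟩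
  exact (intervalIntegral.integral_const_mul A f).symm

theorem HasImproperIntegral.congr {f g : ℝ → ℂ} {L : ℂ} (hf : HasImproperIntegral f L)
    (h : ∀ y, 0 < y → f y = g y) : HasImproperIntegral g L := by
  have hcongr : ∀ R : ℝ, 0 < R → Set.EqOn f g (Set.uIoc 0 R) := fun R hR y hy => by
    rw [Set.uIoc_of_le hR.le] at hy
    exact h y hy.1
  refine ⟨fun R hR => (hf.1 R hR).congr (hcongr R hR), hf.2.congr' ?_⟩
  filter_upwards [eventually_gt_atTop 0] with R hR
  exact intervalIntegral.integral_congr_ae (ae_of_all _ fun y hy => hcongr R hR hy)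

/-! ### The conditionally convergent Basset integral -/

theorem intervalIntegrable_bassetKernel (c : ℝ) {ν : ℂ} (hν : -1 < ν.re) (s : ℂ) (R : ℝ) :
    IntervalIntegrable (bassetKernel c ν s) volume 0 R := by
  have h : IntervalIntegrable (fun y : ℝ => (y : ℂ) ^ (2 * ν + 1)) volume 0 R :=
    intervalIntegral.intervalIntegrable_cpow' (by simp; linarith)
  exact (h.mul_continuousOn (continuous_one_add_sq_cpow (-(s + 1))).continuousOn).mul_continuousOn
    (continuous_besselEntire_neg_sq ν c).continuousOn

/-- A primitive used to integrate `bassetKernel` by parts. -/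
noncomputable def bassetPrimitive (c : ℝ) (ν s : ℂ) (y : ℝ) : ℂ :=
  1 / 2 * ((y : ℂ) ^ (2 * ν + 2) * ((1 + y ^ 2 : ℝ) : ℂ) ^ (-(s + 1)) *
    besselEntire (ν + 1) (-((c * y : ℝ) : ℂ) ^ 2))

/-- Differentiating the outer power and the Bessel factor gives the two terms of
`besselEntire_recurrence`, hence the kernel itself; differentiating the power of `Y` gives the
kernel with both parameters raised. -/
theorem hasDerivAt_bassetPrimitive (c : ℝ) (ν s : ℂ) {y : ℝ} (hy : 0 < y) :
    HasDerivAt (bassetPrimitive c ν s)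
      (bassetKernel c ν s y - (s + 1) * bassetKernel c (ν + 1) (s + 1) y) y := by
  have hpos : 0 < 1 + y ^ 2 := by positivity
  have hy' : (y : ℂ) ≠ 0 := Complex.ofReal_ne_zero.2 hy.ne'
  have h2 : HasDerivAt (fun y : ℝ => ((1 + y ^ 2 : ℝ) : ℂ) ^ (-(s + 1)))
      (((2 * y : ℝ)) • (-(s + 1) * ((1 + y ^ 2 : ℝ) : ℂ) ^ (-(s + 1) - 1))) y := by
    have hq : HasDerivAt (fun y : ℝ => 1 + y ^ 2) (2 * y) y := by
      simpa using (hasDerivAt_pow 2 y).const_add 1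
    exact (hasDerivAt_ofReal_cpow hpos (-(s + 1))).scomp y hq
  refine ((((hasDerivAt_ofReal_cpow hy (2 * ν + 2)).mul h2).mul
    (hasDerivAt_besselEntire_neg_sq (ν + 1) c y)).const_mul (1 / 2)).congr_deriv ?_
  have e1 : (y : ℂ) ^ (2 * ν + 2 - 1) = (y : ℂ) ^ (2 * ν + 1) := by ring_nf
  have e2 : (y : ℂ) ^ (2 * ν + 2) = (y : ℂ) ^ (2 * ν + 1) * y := by
    rw [show 2 * ν + 2 = 2 * ν + 1 + 1 by ring, Complex.cpow_add _ _ hy', Complex.cpow_one]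
  have e3 : (y : ℂ) ^ (2 * (ν + 1) + 1) = (y : ℂ) ^ (2 * ν + 1) * y * y := by
    rw [show 2 * (ν + 1) + 1 = 2 * ν + 1 + 1 + 1 by ring, Complex.cpow_add _ _ hy',
      Complex.cpow_add _ _ hy', Complex.cpow_one]
  simp only [bassetKernel, Pi.mul_apply]
  rw [e1, e2, e3, besselEntire_recurrence ν, show ν + 1 + 1 = ν + 2 by ring,
    show -(s + 1) - 1 = -(s + 1 + 1) by ring, Complex.real_smul]
  push_cast
  ring

theorem continuous_bassetPrimitive (c : ℝ) {ν : ℂ} (hν : -1 < ν.re) (s : ℂ) :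
    Continuous (bassetPrimitive c ν s) := by
  have h : Continuous fun y : ℝ => (y : ℂ) ^ (2 * ν + 2) :=
    Complex.continuous_ofReal_cpow_const (by simp; linarith)
  exact continuous_const.mul ((h.mul (continuous_one_add_sq_cpow _)).mul
    (continuous_besselEntire_neg_sq _ c))

theorem bassetPrimitive_zero (c : ℝ) {ν : ℂ} (hν : -1 < ν.re) (s : ℂ) :
    bassetPrimitive c ν s 0 = 0 := by
  have : 2 * ν + 2 ≠ 0 := fun h => by
    have := congrArg Complex.re h
    simp at this
    linarith
  simp [bassetPrimitive, Complex.zero_cpow this]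

theorem tendsto_bassetPrimitive {c : ℝ} (hc : 0 < c) {ν s : ℂ}
    (hsν : -3 / 2 < (2 * s - ν).re) : Tendsto (bassetPrimitive c ν s) atTop (𝓝 0) := by
  have h2 : (2 * s - ν).re = 2 * s.re - ν.re := by simp
  obtain ⟨C, hC, h⟩ := exists_bound_bassetKernel hc (ν + 1) s
  set q : ℝ := -(s.re + (ν + 1).re / 2 + 5 / 4) with hq
  set D : ℝ := 1 / 2 * (C * (1 + ((1 : ℝ) ^ 2)⁻¹) ^ |q|) with hD
  have hlim : Tendsto (fun y : ℝ => D * y ^ (-(2 * s.re - ν.re + 3 / 2))) atTop (𝓝 0) := by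
    simpa using (tendsto_rpow_neg_atTop (by linarith : 0 < 2 * s.re - ν.re + 3 / 2)).const_mul D
  refine squeeze_zero_norm' ?_ hlim
  filter_upwards [eventually_ge_atTop 1] with y hy
  have hy0 : 0 < y := zero_lt_one.trans_le hy
  have hy' : (y : ℂ) ≠ 0 := Complex.ofReal_ne_zero.2 hy0.ne'
  have e : bassetPrimitive c ν s y = 1 / 2 * (bassetKernel c (ν + 1) s y / y) := by
    rw [bassetPrimitive, bassetKernel, show 2 * (ν + 1) + 1 = 2 * ν + 2 + 1 by ring,
      Complex.cpow_add (2 * ν + 2) 1 hy', Complex.cpow_one]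
    field_simp
  have e2 : y ^ (-(2 * s.re - ν.re + 3 / 2)) = y ^ (2 * (ν + 1).re + 1) * y ^ (2 * q) / y := by
    rw [← Real.rpow_add hy0, ← Real.rpow_sub_one hy0.ne', hq]
    congr 1
    simp
    ring
  have e3 : ‖(1 / 2 : ℂ)‖ = 1 / 2 := by simp
  rw [e, norm_mul, e3, norm_div, Complex.norm_real, Real.norm_of_nonneg hy0.le, e2]
  calc 1 / 2 * (‖bassetKernel c (ν + 1) s y‖ / y)
      ≤ 1 / 2 * (C * (y ^ (2 * (ν + 1).re + 1) *
        ((1 + ((1 : ℝ) ^ 2)⁻¹) ^ |q| * y ^ (2 * q))) / y) := by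
        gcongr
        refine (h y hy0).trans ?_
        gcongr
        exact one_add_sq_rpow_le zero_lt_one hy q
    _ = _ := by rw [hD]; ring

/-- Integration by parts replaces `(ν, s)` by `(ν+1, s+1)`. This raises `2s - ν` by 1, into the
absolutely convergent range, and keeps `s - ν`, hence the order of `K`. The factor `s + 1` is
absorbed by the functional equation of Gamma. -/
theorem hasImproperIntegral_bassetKernel {c : ℝ} (hc : 0 < c) {ν s : ℂ} (hν : -1 < ν.re)
    (hs : -1 < s.re) (hsν : -3 / 2 < (2 * s - ν).re) :
    HasImproperIntegral (bassetKernel c ν s)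
      ((c : ℂ) ^ (s - ν) * besselK (s - ν) (2 * c) / Complex.Gamma (s + 1)) := by
  refine ⟨fun R _ => intervalIntegrable_bassetKernel c hν s R, ?_⟩
  have hν1 : -1 < (ν + 1).re := by simp; linarith
  have hs1 : -1 < (s + 1).re := by simp; linarith
  have hsν1 : -1 / 2 < (2 * (s + 1) - (ν + 1)).re := by simp at hsν ⊢; linarith
  have hi := (hasImproperIntegral_of_integrableOn (integrableOn_bassetKernel hc hν1 hsν1)).2
  rw [integral_bassetKernel hc hν1 hs1 hsν1] at hi
  have hlim := (tendsto_bassetPrimitive hc hsν).add (hi.const_mul (s + 1))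
  have e : 0 + (s + 1) * ((c : ℂ) ^ (s + 1 - (ν + 1)) * besselK (s + 1 - (ν + 1)) (2 * c) /
      Complex.Gamma (s + 1 + 1)) =
      (c : ℂ) ^ (s - ν) * besselK (s - ν) (2 * c) / Complex.Gamma (s + 1) := by
    rw [div_eq_mul_inv _ (Complex.Gamma (s + 1)), inv_Gamma_add_one (s + 1),
      show s + 1 - (ν + 1) = s - ν by ring]
    ring
  rw [e] at hlim
  refine hlim.congr' ?_
  filter_upwards [eventually_gt_atTop 0] with R hR
  have h1 := intervalIntegrable_bassetKernel c hν s R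
  have h2 := (intervalIntegrable_bassetKernel c hν1 (s + 1) R).const_mul (s + 1)
  have := intervalIntegral.integral_eq_sub_of_hasDerivAt_of_le hR.le
    (continuous_bassetPrimitive c hν s).continuousOn
    (fun y hy => hasDerivAt_bassetPrimitive c ν s hy.1) (h1.sub h2)
  rw [intervalIntegral.integral_sub h1 h2, intervalIntegral.integral_const_mul,
    bassetPrimitive_zero c hν, sub_zero] at this
  rw [← this]
  ring

/-! ### Pochhammer symbols and expansion of the integrand in powers of `a` -/

theorem ascPochhammer_eval_mul_inv_Gamma (b : ℂ) (n : ℕ) :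
    (ascPochhammer ℂ n).eval b * (Complex.Gamma (b + n))⁻¹ = (Complex.Gamma b)⁻¹ := by
  induction n with
  | zero => simp
  | succ n ih =>
    rw [← ih, ascPochhammer_succ_eval, inv_Gamma_add_one (b + n)]
    push_cast
    ring_nf

theorem Gamma_mul_inv_Gamma_add_nat {b : ℂ} (hb : Complex.Gamma b ≠ 0) (n : ℕ) :
    Complex.Gamma b * (Complex.Gamma (b + n))⁻¹ = ((ascPochhammer ℂ n).eval b)⁻¹ := by
  have h := ascPochhammer_eval_mul_inv_Gamma b n
  refine eq_inv_of_mul_eq_one_left ?_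
  rw [mul_assoc, mul_comm _ (Polynomial.eval _ _), h, mul_inv_cancel₀ hb]

theorem HasImproperIntegral.sum {ι : Type*} (s : Finset ι) {f : ι → ℝ → ℂ} {L : ι → ℂ}
    (h : ∀ i ∈ s, HasImproperIntegral (f i) (L i)) :
    HasImproperIntegral (fun y => ∑ i ∈ s, f i y) (∑ i ∈ s, L i) := by
  classical
  induction s using Finset.induction_on with
  | empty => exact ⟨fun _ _ => by simp, by simp⟩
  | insert i s hi ih =>
    simp only [Finset.sum_insert hi]
    exact (h i (Finset.mem_insert_self _ _)).add
      (ih fun j hj => h j (Finset.mem_insert_of_mem hj))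

theorem HasImproperIntegral.integral_eq {f : ℝ → ℂ} {L : ℂ} (hf : HasImproperIntegral f L)
    (hi : IntegrableOn f (Set.Ioi 0)) : ∫ y in Set.Ioi (0 : ℝ), f y = L :=
  tendsto_nhds_unique (hasImproperIntegral_of_integrableOn hi).2 hf.2

theorem bassetKernel_add_nat (c : ℝ) (ν s : ℂ) (k : ℕ) (y : ℝ) :
    bassetKernel c ν (s + k) y = bassetKernel c ν s y * (((1 + y ^ 2 : ℝ) : ℂ) ^ k)⁻¹ := by
  have hpos : ((1 + y ^ 2 : ℝ) : ℂ) ≠ 0 := Complex.ofReal_ne_zero.2 (by positivity)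
  rw [bassetKernel, bassetKernel, show -(s + k + 1) = -(s + 1) - k by ring,
    Complex.cpow_sub _ _ hpos, Complex.cpow_natCast]
  ring

/-- The term of order `2 * n` in `a` of the expansion of the integrand. -/
noncomputable def expansionTerm (a c : ℝ) (μ ν : ℂ) (n : ℕ) (y : ℝ) : ℂ :=
  ((2 * a : ℂ) ^ 2) ^ n * ∑ m ∈ Finset.range (n + 1),
    (-1) ^ m * jacobiCoeff μ ν n m * bassetKernel c ν (μ + ν + (n + m : ℕ)) y

theorem expansionTerm_eq (a c : ℝ) (μ ν : ℂ) (n : ℕ) (y : ℝ) :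
    expansionTerm a c μ ν n y = bassetKernel c ν (μ + ν) y *
      ∑ p ∈ Finset.HasAntidiagonal.antidiagonal n,
        (-((2 * a / (1 + y ^ 2) : ℝ) : ℂ) ^ 2) ^ p.1 /
          ((p.1.factorial : ℂ) * Complex.Gamma (μ + p.1 + 1)) *
        ((((2 * a * y / (1 + y ^ 2) : ℝ) : ℂ) ^ 2) ^ p.2 /
          ((p.2.factorial : ℂ) * Complex.Gamma (ν + p.2 + 1))) := by
  set Y : ℂ := ((1 + y ^ 2 : ℝ) : ℂ) with hY
  have hY0 : Y ≠ 0 := Complex.ofReal_ne_zero.2 (by positivity)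
  have hY1 : Y - 1 = (y : ℂ) ^ 2 := by rw [hY]; push_cast; ring
  have h1 : ∑ p ∈ Finset.HasAntidiagonal.antidiagonal n,
        (-((2 * a / (1 + y ^ 2) : ℝ) : ℂ) ^ 2) ^ p.1 /
          ((p.1.factorial : ℂ) * Complex.Gamma (μ + p.1 + 1)) *
        ((((2 * a * y / (1 + y ^ 2) : ℝ) : ℂ) ^ 2) ^ p.2 /
          ((p.2.factorial : ℂ) * Complex.Gamma (ν + p.2 + 1))) =
      ((2 * a / Y) ^ 2) ^ n * ∑ m ∈ Finset.range (n + 1),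
        (-1) ^ m * jacobiCoeff μ ν n m * Y ^ (n - m) := by
    rw [← sum_antidiagonal_sub_one_pow, Finset.mul_sum]
    refine Finset.sum_congr rfl fun p hp => ?_
    rw [← Finset.HasAntidiagonal.mem_antidiagonal.1 hp, hY1, pow_add,
      show (-((2 * a / (1 + y ^ 2) : ℝ) : ℂ) ^ 2) = -1 * (2 * a / Y) ^ 2 by rw [hY]; push_cast; ring,
      show ((2 * a * y / (1 + y ^ 2) : ℝ) : ℂ) ^ 2 = (2 * a / Y) ^ 2 * y ^ 2 by
        rw [hY]; push_cast; ring, mul_pow (-1), mul_pow _ ((y : ℂ) ^ 2)]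
    ring
  rw [h1, expansionTerm, mul_left_comm, Finset.mul_sum, Finset.mul_sum, Finset.mul_sum]
  refine Finset.sum_congr rfl fun m hm => ?_
  have hm : m ≤ n := Nat.lt_succ_iff.1 (Finset.mem_range.1 hm)
  have e : Y ^ n * Y ^ n = Y ^ (n + m) * Y ^ (n - m) := by
    rw [← pow_add, ← pow_add]; congr 1; omega
  have e' : (Y ^ (n + m))⁻¹ = ((Y ^ 2)⁻¹) ^ n * Y ^ (n - m) := by
    rw [inv_pow, ← pow_mul, two_mul, pow_add Y n n, e, mul_inv, mul_assoc,
      inv_mul_cancel₀ (pow_ne_zero _ hY0), mul_one]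
  rw [bassetKernel_add_nat, ← hY, e', div_pow, div_eq_mul_inv, mul_pow]
  ring

theorem tsum_expansionTerm (a c : ℝ) (μ ν : ℂ) (y : ℝ) :
    ∑' n, expansionTerm a c μ ν n y = bassetKernel c ν (μ + ν) y *
      (besselEntire μ (-((2 * a / (1 + y ^ 2) : ℝ) : ℂ) ^ 2) *
        besselEntire ν (((2 * a * y / (1 + y ^ 2) : ℝ) : ℂ) ^ 2)) := by
  simp only [expansionTerm_eq]
  rw [tsum_mul_left, besselEntire, besselEntire,
    tsum_mul_tsum_eq_tsum_sum_antidiagonal_of_summable_norm (summable_norm_besselEntire _ _)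
      (summable_norm_besselEntire _ _)]

/-- The majorant of `expansionTerm`. -/
noncomputable def expansionBound (a : ℝ) (μ ν : ℂ) (n : ℕ) : ℝ :=
  ∑ p ∈ Finset.HasAntidiagonal.antidiagonal n,
    ‖((2 * a : ℂ) ^ 2) ^ p.1 / ((p.1.factorial : ℂ) * Complex.Gamma (μ + p.1 + 1))‖ *
      ‖((2 * a : ℂ) ^ 2) ^ p.2 / ((p.2.factorial : ℂ) * Complex.Gamma (ν + p.2 + 1))‖

theorem summable_expansionBound (a : ℝ) (μ ν : ℂ) : Summable (expansionBound a μ ν) := by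
  have h1 := (summable_norm_besselEntire μ ((2 * a : ℂ) ^ 2)).norm
  have h2 := (summable_norm_besselEntire ν ((2 * a : ℂ) ^ 2)).norm
  exact (summable_norm_sum_mul_antidiagonal_of_summable_norm h1 h2).of_norm

/-- Both `(2a/Y)²` and `(2ay/Y)²` are at most `(2a)²/Y`, so the term of index `n + 1` gains
`Y^(-(n+1)) ≤ Y⁻¹`. One factor `Y⁻¹` shifts `s` by 1, giving a kernel independent of `n`. -/
theorem norm_expansionTerm_succ_le (a c : ℝ) (μ ν : ℂ) (n : ℕ) (y : ℝ) :
    ‖expansionTerm a c μ ν (n + 1) y‖ ≤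
      expansionBound a μ ν (n + 1) * ‖bassetKernel c ν (μ + ν + (1 : ℕ)) y‖ := by
  have hY : 1 ≤ 1 + y ^ 2 := by nlinarith [sq_nonneg y]
  have hY0 : 0 < 1 + y ^ 2 := by positivity
  have hterm : ∀ p ∈ Finset.HasAntidiagonal.antidiagonal (n + 1),
      ‖(-((2 * a / (1 + y ^ 2) : ℝ) : ℂ) ^ 2) ^ p.1 /
          ((p.1.factorial : ℂ) * Complex.Gamma (μ + p.1 + 1)) *
        ((((2 * a * y / (1 + y ^ 2) : ℝ) : ℂ) ^ 2) ^ p.2 /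
          ((p.2.factorial : ℂ) * Complex.Gamma (ν + p.2 + 1)))‖ ≤
      (1 + y ^ 2)⁻¹ *
        (‖((2 * a : ℂ) ^ 2) ^ p.1 / ((p.1.factorial : ℂ) * Complex.Gamma (μ + p.1 + 1))‖ *
      ‖((2 * a : ℂ) ^ 2) ^ p.2 / ((p.2.factorial : ℂ) * Complex.Gamma (ν + p.2 + 1))‖) := by
    intro p hp
    have hn : ∀ (x : ℝ) (k : ℕ) (D : ℂ), ‖((x : ℂ) ^ 2) ^ k / D‖ = (x ^ 2) ^ k / ‖D‖ := by
      intro x k D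
      rw [norm_div, norm_pow, norm_pow, Complex.norm_real, Real.norm_eq_abs, sq_abs]
    have hn' : ∀ (x : ℝ) (k : ℕ) (D : ℂ), ‖(-(x : ℂ) ^ 2) ^ k / D‖ = (x ^ 2) ^ k / ‖D‖ := by
      intro x k D
      rw [norm_div, norm_pow, norm_neg, norm_pow, Complex.norm_real, Real.norm_eq_abs, sq_abs]
    rw [show (2 * a : ℂ) = ((2 * a : ℝ) : ℂ) by push_cast; rfl, norm_mul, hn', hn, hn, hn]
    set G₁ := ‖(p.1.factorial : ℂ) * Complex.Gamma (μ + p.1 + 1)‖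
    set G₂ := ‖(p.2.factorial : ℂ) * Complex.Gamma (ν + p.2 + 1)‖
    have h1 : (2 * a / (1 + y ^ 2)) ^ 2 ≤ (2 * a) ^ 2 * (1 + y ^ 2)⁻¹ := by
      rw [div_pow, div_eq_mul_inv]
      gcongr
      nlinarith
    have h2 : (2 * a * y / (1 + y ^ 2)) ^ 2 ≤ (2 * a) ^ 2 * (1 + y ^ 2)⁻¹ := by
      have : (2 * a * y / (1 + y ^ 2)) ^ 2 = (2 * a) ^ 2 * (1 + y ^ 2)⁻¹ * (y ^ 2 / (1 + y ^ 2)) := by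
        field_simp
      rw [this]
      refine mul_le_of_le_one_right (by positivity) ?_
      rw [div_le_one hY0]
      linarith
    have h3 : ((1 + y ^ 2)⁻¹) ^ (n + 1) ≤ (1 + y ^ 2)⁻¹ :=
      pow_le_of_le_one (by positivity) (inv_le_one_of_one_le₀ hY) n.succ_ne_zero
    calc ((2 * a / (1 + y ^ 2)) ^ 2) ^ p.1 / G₁ * (((2 * a * y / (1 + y ^ 2)) ^ 2) ^ p.2 / G₂)
        ≤ ((2 * a) ^ 2 * (1 + y ^ 2)⁻¹) ^ p.1 / G₁ *
          (((2 * a) ^ 2 * (1 + y ^ 2)⁻¹) ^ p.2 / G₂) := by gcongr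
      _ = ((1 + y ^ 2)⁻¹) ^ (n + 1) * (((2 * a) ^ 2) ^ p.1 / G₁ * (((2 * a) ^ 2) ^ p.2 / G₂)) := by
        rw [← Finset.HasAntidiagonal.mem_antidiagonal.1 hp, pow_add, mul_pow, mul_pow _ _ p.2]
        ring
      _ ≤ _ := by gcongr
  have hk : ‖bassetKernel c ν (μ + ν + (1 : ℕ)) y‖ =
      ‖bassetKernel c ν (μ + ν) y‖ * (1 + y ^ 2)⁻¹ := by
    rw [bassetKernel_add_nat, norm_mul, pow_one, norm_inv, Complex.norm_real,
      Real.norm_of_nonneg hY0.le]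
  rw [expansionTerm_eq, norm_mul, hk, expansionBound]
  calc _ ≤ ‖bassetKernel c ν (μ + ν) y‖ * ((1 + y ^ 2)⁻¹ *
      ∑ p ∈ Finset.HasAntidiagonal.antidiagonal (n + 1),
        (‖((2 * a : ℂ) ^ 2) ^ p.1 / ((p.1.factorial : ℂ) * Complex.Gamma (μ + p.1 + 1))‖ *
      ‖((2 * a : ℂ) ^ 2) ^ p.2 / ((p.2.factorial : ℂ) * Complex.Gamma (ν + p.2 + 1))‖)) := by
        refine mul_le_mul_of_nonneg_left ?_ (norm_nonneg _)
        rw [Finset.mul_sum]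
        exact (norm_sum_le _ _).trans (Finset.sum_le_sum hterm)
    _ = _ := by ring

theorem hasImproperIntegral_expansionTerm (a : ℝ) {c : ℝ} (hc : 0 < c) {μ ν : ℂ}
    (hν : -1 < ν.re) (hμν : -1 < (μ + ν).re) (h2μν : -3 / 2 < (2 * μ + ν).re) (n : ℕ) :
    HasImproperIntegral (expansionTerm a c μ ν n)
      ((c : ℂ) ^ μ * besselK μ (2 * c) * ((-(2 * a * c : ℂ) ^ 2) ^ n / n.factorial *
        ((Complex.Gamma (μ + 1 + n))⁻¹ * (Complex.Gamma (ν + 1 + n))⁻¹ *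
          (Complex.Gamma (μ + ν + 1 + n))⁻¹))) := by
  have hc' : (c : ℂ) ≠ 0 := Complex.ofReal_ne_zero.2 hc.ne'
  have h : ∀ m ∈ Finset.range (n + 1), HasImproperIntegral
      (fun y => (-1) ^ m * jacobiCoeff μ ν n m * bassetKernel c ν (μ + ν + (n + m : ℕ)) y)
      ((-1) ^ m * jacobiCoeff μ ν n m * ((c : ℂ) ^ (μ + ν + (n + m : ℕ) - ν) *
        besselK (μ + ν + (n + m : ℕ) - ν) (2 * c) /
          Complex.Gamma (μ + ν + (n + m : ℕ) + 1))) := by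
    intro m _
    have hnm : (0 : ℝ) ≤ (n + m : ℕ) := Nat.cast_nonneg _
    refine (hasImproperIntegral_bassetKernel hc hν ?_ ?_).const_mul _
    · rw [Complex.add_re, Complex.natCast_re]
      linarith
    · have : 2 * (μ + ν + (n + m : ℕ)) - ν = 2 * μ + ν + ((2 * (n + m) : ℕ) : ℂ) := by
        push_cast; ring
      rw [this, Complex.add_re, Complex.natCast_re]
      push_cast at hnm ⊢
      linarith
  have hsum := (HasImproperIntegral.sum _ h).const_mul (((2 * a : ℂ) ^ 2) ^ n)
  convert! hsum using 1
  have hK := besselKSum_eq hc n μ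
  have hterm : ∀ m ∈ Finset.range (n + 1), (-1) ^ m * jacobiCoeff μ ν n m *
      ((c : ℂ) ^ (μ + ν + (n + m : ℕ) - ν) * besselK (μ + ν + (n + m : ℕ) - ν) (2 * c) /
        Complex.Gamma (μ + ν + (n + m : ℕ) + 1)) =
      (c : ℂ) ^ μ * (c : ℂ) ^ n / n.factorial * (Complex.Gamma (ν + n + 1))⁻¹ *
        (Complex.Gamma (μ + ν + n + 1))⁻¹ * ((n.choose m : ℂ) *
        ((-c : ℂ) ^ m * besselK (μ + n + m) (2 * c) * (Complex.Gamma (μ + m + 1))⁻¹)) := by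
    intro m _
    -- The Pochhammer factor of `jacobiCoeff` turns `1/Γ(μ+ν+n+m+1)` into `1/Γ(μ+ν+n+1)`, free of
    -- `m`, so only the binomial sum of `K` remains.
    have hG := ascPochhammer_eval_mul_inv_Gamma (μ + ν + n + 1) m
    have e1 : μ + ν + ((n + m : ℕ) : ℂ) - ν = μ + n + m := by push_cast; ring
    have e2 : μ + ν + ((n + m : ℕ) : ℂ) + 1 = μ + ν + n + 1 + m := by push_cast; ring
    have e3 : (c : ℂ) ^ (μ + n + m) = (c : ℂ) ^ μ * (c : ℂ) ^ n * (c : ℂ) ^ m := by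
      rw [Complex.cpow_add _ _ hc', Complex.cpow_add _ _ hc', Complex.cpow_natCast,
        Complex.cpow_natCast]
    have e4 : (-c : ℂ) ^ m = (-1) ^ m * (c : ℂ) ^ m := neg_pow _ _
    rw [e1, e2, e3, e4, ← hG, jacobiCoeff]
    ring
  rw [Finset.sum_congr rfl hterm, ← Finset.mul_sum]
  rw [besselKSum] at hK
  rw [hK, show μ + 1 + n = μ + n + 1 by ring, show ν + 1 + n = ν + n + 1 by ring,
    show μ + ν + 1 + n = μ + ν + n + 1 by ring,
    show (-(2 * a * c : ℂ) ^ 2) = (2 * a) ^ 2 * (c * (-c)) by ring, mul_pow, mul_pow (c : ℂ)]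
  ring

/-! ### Reassembly of the integrand and termwise integration -/

theorem integrand_eq (a t y : ℝ) (ha : 0 < a) (ht : 0 < t) (hy : 0 < y) (μ ν : ℂ) :
    (y : ℂ) / (1 + (y : ℂ) ^ 2) * besselJ ν ((t * y : ℝ) : ℂ) *
      besselJ μ ((4 * a / (1 + y ^ 2) : ℝ) : ℂ) * besselI ν ((4 * a * y / (1 + y ^ 2) : ℝ) : ℂ) =
    ((t / 2 : ℝ) : ℂ) ^ ν * ((2 * a : ℝ) : ℂ) ^ (μ + ν) *
      ∑' n, expansionTerm a (t / 2) μ ν n y := by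
  have hJ : ∀ ν z : ℂ, besselJ ν z = (z / 2) ^ ν * besselEntire ν (-(z / 2) ^ 2) := by
    intro ν z
    rw [besselJ, besselEntire]
    congr 1
    refine tsum_congr fun k => ?_
    rw [neg_pow ((z / 2) ^ 2), pow_mul]
  have hI : ∀ ν z : ℂ, besselI ν z = (z / 2) ^ ν * besselEntire ν ((z / 2) ^ 2) := by
    intro ν z
    rw [besselI, besselEntire]
    congr 1
    refine tsum_congr fun k => ?_
    rw [pow_mul]
  have hY : 0 < 1 + y ^ 2 := by positivity
  have hY' : ((1 + y ^ 2 : ℝ) : ℂ) ≠ 0 := Complex.ofReal_ne_zero.2 hY.ne'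
  have hy' : (y : ℂ) ≠ 0 := Complex.ofReal_ne_zero.2 hy.ne'
  have ha2 : ((2 * a : ℝ) : ℂ) ≠ 0 := Complex.ofReal_ne_zero.2 (by positivity)
  have e1 : ((t * y : ℝ) : ℂ) / 2 = ((t / 2 * y : ℝ) : ℂ) := by push_cast; ring
  have e2 : ((4 * a / (1 + y ^ 2) : ℝ) : ℂ) / 2 = ((2 * a / (1 + y ^ 2) : ℝ) : ℂ) := by
    push_cast; ring
  have e3 : ((4 * a * y / (1 + y ^ 2) : ℝ) : ℂ) / 2 = ((2 * a * y / (1 + y ^ 2) : ℝ) : ℂ) := by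
    push_cast; ring
  have hinv : ∀ r : ℂ, (((1 + y ^ 2)⁻¹ : ℝ) : ℂ) ^ r = ((1 + y ^ 2 : ℝ) : ℂ) ^ (-r) := by
    intro r
    rw [Complex.ofReal_inv, Complex.inv_cpow _ _
      (by rw [Complex.arg_ofReal_of_nonneg hY.le]; exact Real.pi_pos.ne), Complex.cpow_neg]
  have p1 : ((t / 2 * y : ℝ) : ℂ) ^ ν = ((t / 2 : ℝ) : ℂ) ^ ν * (y : ℂ) ^ ν := by
    rw [Complex.ofReal_mul, Complex.mul_cpow_ofReal_nonneg (by positivity) hy.le]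
  have p2 : ((2 * a / (1 + y ^ 2) : ℝ) : ℂ) ^ μ =
      ((2 * a : ℝ) : ℂ) ^ μ * ((1 + y ^ 2 : ℝ) : ℂ) ^ (-μ) := by
    rw [div_eq_mul_inv, Complex.ofReal_mul, Complex.mul_cpow_ofReal_nonneg (by positivity)
      (by positivity), hinv]
  have p3 : ((2 * a * y / (1 + y ^ 2) : ℝ) : ℂ) ^ ν =
      ((2 * a : ℝ) : ℂ) ^ ν * (y : ℂ) ^ ν * ((1 + y ^ 2 : ℝ) : ℂ) ^ (-ν) := by
    rw [div_eq_mul_inv, Complex.ofReal_mul, Complex.mul_cpow_ofReal_nonneg (by positivity)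
      (by positivity), hinv, Complex.ofReal_mul, Complex.mul_cpow_ofReal_nonneg (by positivity)
      hy.le]
  have p4 : (y : ℂ) ^ (2 * ν + 1) = (y : ℂ) ^ ν * (y : ℂ) ^ ν * y := by
    rw [two_mul, Complex.cpow_add _ _ hy', Complex.cpow_add _ _ hy', Complex.cpow_one]
  have p5 : ((1 + y ^ 2 : ℝ) : ℂ) ^ (-(μ + ν + 1)) = ((1 + y ^ 2 : ℝ) : ℂ) ^ (-μ) *
      ((1 + y ^ 2 : ℝ) : ℂ) ^ (-ν) * (1 + (y : ℂ) ^ 2)⁻¹ := by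
    rw [show -(μ + ν + 1) = -μ + -ν + -1 by ring, Complex.cpow_add _ _ hY',
      Complex.cpow_add _ _ hY', Complex.cpow_neg_one]
    push_cast; ring
  rw [hJ, hJ, hI, e1, e2, e3, tsum_expansionTerm, bassetKernel, p1, p2, p3, p4, p5,
    Complex.cpow_add _ _ ha2]
  ring

/-- Termwise improper integration when all terms but the first are dominated by a multiple of a
fixed integrable function with summable factors. -/
theorem hasImproperIntegral_tsum {T : ℕ → ℝ → ℂ} {V : ℕ → ℂ} {k : ℝ → ℂ} {B : ℕ → ℝ}
    (hTV : ∀ n, HasImproperIntegral (T n) (V n)) (hcont : ∀ n, ContinuousOn (T n) (Set.Ioi 0))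
    (hk : IntegrableOn k (Set.Ioi 0)) (hB : Summable B)
    (hbound : ∀ n y, ‖T (n + 1) y‖ ≤ B n * ‖k y‖) :
    HasImproperIntegral (fun y => ∑' n, T n y) (∑' n, V n) := by
  -- The term of index 0 stays outside the dominated argument and enters only through its improper
  -- integral.
  have hint : ∀ n, IntegrableOn (T (n + 1)) (Set.Ioi 0) := fun n =>
    Integrable.mono' (hk.norm.const_mul (B n))
      ((hcont _).aestronglyMeasurable measurableSet_Ioi) (ae_of_all _ fun y => hbound n y)
  have hnorm : Summable fun n => ∫ y in Set.Ioi (0 : ℝ), ‖T (n + 1) y‖ := by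
    refine Summable.of_nonneg_of_le (fun n => integral_nonneg fun _ => norm_nonneg _) (fun n => ?_)
      (hB.mul_right (∫ y in Set.Ioi (0 : ℝ), ‖k y‖))
    rw [← integral_const_mul]
    exact integral_mono (hint n).norm (hk.norm.const_mul _) fun y => hbound n y
  have hGsum : ∀ y, Summable fun n => T (n + 1) y := fun y =>
    Summable.of_norm_bounded (hB.mul_right ‖k y‖) fun n => hbound n y
  have hG : IntegrableOn (fun y => ∑' n, T (n + 1) y) (Set.Ioi 0) := by
    refine Integrable.mono' (hk.norm.const_mul (∑' n, B n)) ?_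
      (ae_of_all _ fun y => ?_)
    · refine aestronglyMeasurable_of_tendsto_ae atTop
        (f := fun (N : ℕ) y => ∑ n ∈ Finset.range N, T (n + 1) y) (fun N => ?_)
        (ae_of_all _ fun y => (hGsum y).hasSum.tendsto_sum_nat)
      exact (continuousOn_finsetSum _ fun n _ => hcont (n + 1)).aestronglyMeasurable
        measurableSet_Ioi
    · rw [← tsum_mul_right]
      exact tsum_of_norm_bounded (hB.mul_right ‖k y‖).hasSum fun n => hbound n y
  have hGV : HasSum (fun n => V (n + 1)) (∫ y in Set.Ioi (0 : ℝ), ∑' n, T (n + 1) y) := by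
    have := hasSum_integral_of_summable_integral_norm hint hnorm
    simpa only [fun n => (hTV (n + 1)).integral_eq (hint n)] using this
  have hVsum : ∑' n, V n = V 0 + ∫ y in Set.Ioi (0 : ℝ), ∑' n, T (n + 1) y := by
    rw [← hGV.tsum_eq]
    exact tsum_eq_zero_add' hGV.summable
  rw [hVsum]
  refine ((hTV 0).add (hasImproperIntegral_of_integrableOn hG)).congr fun y _ => ?_
  exact (tsum_eq_zero_add' (f := fun n => T n y) (hGsum y)).symm

theorem mainTheorem7 (μ ν : ℂ) (a t : ℝ) (ha : 0 < a) (ht : 0 < t)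
    (hν : -1 < ν.re) (hμν : -1 < (μ + ν).re) (h2μν : -3 / 2 < (2 * μ + ν).re)
    (hμ : ∀ n : ℕ, μ + 1 ≠ -(n : ℂ)) :
    ∃ L : ℂ,
      HasImproperIntegral
        (fun y : ℝ => (y : ℂ) / (1 + (y : ℂ) ^ 2) * besselJ ν ((t * y : ℝ) : ℂ) *
          besselJ μ ((4 * a / (1 + y ^ 2) : ℝ) : ℂ) *
          besselI ν ((4 * a * y / (1 + y ^ 2) : ℝ) : ℂ)) L ∧
      ((a * t : ℝ) : ℂ) ^ (μ + ν) *
          hypergeometric0F3 (μ + 1) (ν + 1) (μ + ν + 1) (-(a : ℂ) ^ 2 * (t : ℂ) ^ 2) *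
          besselK μ t =
        Complex.Gamma (μ + 1) * Complex.Gamma (ν + 1) * Complex.Gamma (μ + ν + 1) * L := by
  set c : ℝ := t / 2 with hc_def
  have hc : 0 < c := by positivity
  set T := expansionTerm a c μ ν with hT
  set A : ℂ := ((t / 2 : ℝ) : ℂ) ^ ν * ((2 * a : ℝ) : ℂ) ^ (μ + ν) with hA
  set V : ℕ → ℂ := fun n => (c : ℂ) ^ μ * besselK μ (2 * c) *
    ((-(2 * a * c : ℂ) ^ 2) ^ n / n.factorial * ((Complex.Gamma (μ + 1 + n))⁻¹ *
      (Complex.Gamma (ν + 1 + n))⁻¹ * (Complex.Gamma (μ + ν + 1 + n))⁻¹)) with hV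
  have hTV : ∀ n, HasImproperIntegral (T n) (V n) :=
    hasImproperIntegral_expansionTerm a hc hν hμν h2μν
  set k : ℝ → ℂ := bassetKernel c ν (μ + ν + (1 : ℕ)) with hk_def
  -- With `s = μ + ν + 1`, `2s - ν` equals `2μ + ν + 2`, whose real part exceeds `1/2`.
  have hk : IntegrableOn k (Set.Ioi 0) := by
    refine integrableOn_bassetKernel hc hν ?_
    have : 2 * (μ + ν + (1 : ℕ)) - ν = 2 * μ + ν + ((2 : ℕ) : ℂ) := by push_cast; ring
    rw [this, Complex.add_re, Complex.natCast_re]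
    push_cast
    linarith
  have hcont : ∀ n, ContinuousOn (T n) (Set.Ioi 0) := fun n =>
    continuousOn_const.mul (continuousOn_finsetSum _ fun m _ =>
      continuousOn_const.mul (continuousOn_bassetKernel _ _ _))
  have hI := hasImproperIntegral_tsum hTV hcont hk
    ((summable_nat_add_iff 1).2 (summable_expansionBound a μ ν))
    (norm_expansionTerm_succ_le a c μ ν)
  refine ⟨A * ∑' n, V n, ?_, ?_⟩
  · exact (hI.const_mul A).congr fun y hy => (integrand_eq a t y ha ht hy μ ν).symm
  · have g1 : Complex.Gamma (μ + 1) ≠ 0 := Complex.Gamma_ne_zero hμ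
    have g2 : Complex.Gamma (ν + 1) ≠ 0 :=
      Complex.Gamma_ne_zero_of_re_pos (by simpa using by linarith)
    have g3 : Complex.Gamma (μ + ν + 1) ≠ 0 :=
      Complex.Gamma_ne_zero_of_re_pos (by rw [Complex.add_re, Complex.one_re]; linarith)
    have hc' : (c : ℂ) ≠ 0 := Complex.ofReal_ne_zero.2 hc.ne'
    have h2c : 2 * c = t := by rw [hc_def]; ring
    have hpow : ((a * t : ℝ) : ℂ) ^ (μ + ν) = A * (c : ℂ) ^ μ := by
      rw [hA, ← hc_def, show a * t = 2 * a * c by rw [hc_def]; ring, Complex.ofReal_mul,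
        Complex.mul_cpow_ofReal_nonneg (by positivity) hc.le, Complex.cpow_add μ ν hc']
      ring
    have hat : (-(2 * a * c : ℂ) ^ 2) = -(a : ℂ) ^ 2 * (t : ℂ) ^ 2 := by
      rw [← h2c]; push_cast; ring
    have hF : hypergeometric0F3 (μ + 1) (ν + 1) (μ + ν + 1) (-(a : ℂ) ^ 2 * (t : ℂ) ^ 2) *
        ((c : ℂ) ^ μ * besselK μ t) =
        Complex.Gamma (μ + 1) * Complex.Gamma (ν + 1) * Complex.Gamma (μ + ν + 1) *
          ∑' n, V n := by
      rw [hypergeometric0F3, ← tsum_mul_left, ← tsum_mul_right]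
      refine tsum_congr fun n => ?_
      simp only [hV]
      rw [hat, h2c, div_eq_mul_inv, mul_inv, mul_inv, mul_inv, ← Gamma_mul_inv_Gamma_add_nat g1,
        ← Gamma_mul_inv_Gamma_add_nat g2, ← Gamma_mul_inv_Gamma_add_nat g3]
      ring
    rw [hpow]
    linear_combination A * hF
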